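/- **Setting.** For a manifold $Z$ with a distribution $\Delta$, the (Cartan) prolongation is the manifold $\mathbb P(\Delta)=\{(p,\ell): p\in Z,\ \ell\subset\Delta(p)\text{ a line}\}$ with the distribution $\Delta^1(p,\ell)=d\pi_{(p,\ell)}^{-1}(\ell)$, where $\pi(p,\ell)=p$. The $\mathbb R^3$-Monster Tower $(\mathcal P^k,\Delta_k)_{k\ge 0}$ starts with $(\mathcal P^0,\Delta_0)=(\mathbb R^3,T\mathbb R^3)$, and $(\mathcal P^{k+1},\Delta_{k+1})$ is the prolongation of $(\mathcal P^k,\Delta_k)$; each $\Delta_k$ has rank $3$. For $i\ge1$ and $p_{i-1}\in\mathcal P^{i-1}$ let $F_i\subset\mathcal P^i$ be the fiber over $p_{i-1}$. Prolonging $(F_i,TF_i)$ $j$ times gives a submanifold $\mathcal P^j(F_i)\subset\mathcal P^{i+j}$ with a distribution $\delta_i^j\subset\Delta_{i+j}$ of planes (a *Baby Monster*). The planes $\delta_i^j(q)$, for all $i\ge 1$, $j\ge 0$ with $i+j=k$ and all $F_i$ with $q\in\mathcal P^j(F_i)$, are the *critical planes* at $q\in\mathcal P^k$. The *vertical plane*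 is $V=\delta_k^0(q)$, the tangent space of the fiber through $q$. *Kumpera–Rubin coordinates* at $q=p_k\in\mathcal P^k$, with projections $p_{i+1}=(p_i,\ell_i)$ for $0\le i<k$, come with a coframing $[df_i:du_i:dv_i]$ of $\Delta_i$ near $p_i$. At level $0$ it is $[dx:dy:dz]$. At level $i+1$, $f_{i+1}$ is the first of the three functions $f_i,u_i,v_i$ (of $x,y,z$ if $i=0$) whose differential does not vanish on $\ell_i$, and $u_{i+1},v_{i+1}$ are the quotients, on the line, of the other two differentials by $df_{i+1}$, in their order. If the plane $du_k=0$ in $\Delta_k(q)$ is critical it is called $T_1$; if the plane $dv_k=0$ in $\Delta_k(q)$ is critical it is called $T_2$. Where the planes involved exist, put $L_1=V\cap T_1$, $L_2=T_1\cap T_2$, $L_3=V\cap T_2$. A line $\ell\subset\Delta_k(p)$ is a *critical direction* if some immersed integral curve of $\Delta_k$ through $p$ is tangent to $\ell$ and projects to a constant curve in $\mathbb R^3$; otherwise it is *regular*. The letter of $(p,\ell)\in\mathcal P^{k+1}$ is $R$ if $\ell$ is regular. If $\ell$ is critical, the letter is $L_1$, $L_2$ or $L_3$ if $\ell$ is that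 line, and $V$, $T_1$ or $T_2$ if $\ell$ lies in that critical plane and in no other of the planes $V,T_1,T_2$ at $p$. The *RVT code* of $p\in\mathcal P^k$ is the word of length $k$ whose $i$-th letter is the letter of the projection of $p$ to $\mathcal P^i$. **Theorem 2.1.** Every point of the $\mathbb R^3$-Monster Tower has exactly one RVT code. The complete spelling rules for RVT codes are as follows. 1. Every RVT code (of a point of level $k\ge1$) begins with the letter $R$. 2. $R$ may be followed by exactly $R, V$. 3. $V$ and $T_1$ may each be followed by exactly $R, V, T_1, L_1$. 4. $L_1$, $L_2$ and $L_3$ may each be followed by exactly $R, V, T_1, T_2, L_1, L_2, L_3$. 5. $T_2$ may be followed by exactly $R, V, T_2, L_3$. Here "may be followed by exactly" means: over every point $p$ of level $k\ge 1$ whose code ends in the given letter, the letters of the points of $\mathcal P^{k+1}$ that project to $p$ are exactly the listed ones. Consequently a nonempty word in the letters $R,V,T_1,T_2,L_1,L_2,L_3$ is the RVT code of some point of the tower if and only if it begins with $R$ and each of its letters is allowed, by rules 2–5, after the letter before it. -/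

import Mathlib

open scoped ContDiff Topology

noncomputable section

namespace Monster

/-! ### Distributions and Cartan prolongation

Everything is embedded in Euclidean spaces.  A line in `ℝ^ι` is represented by the matrix of the
orthogonal projection onto it, which embeds the projective space of `ℝ^ι` in `ℝ^(ι × ι)`. -/

/-- A subset `carrier` of `ℝ^ι` (in practice an embedded submanifold), together with a linear
subspace `dist p` of `ℝ^ι` for each point `p` (in practice a distribution, a subbundle of the
tangent bundle of `carrier`). -/
structure DistSpace (ι : Type) where
  carrier : Set (ι → ℝ)
  dist : (ι → ℝ) → Submodule ℝ (ι → ℝ)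

section Prolongation

variable {ι : Type} [Fintype ι]

/-- The tangent space at `p` of a submanifold `Z` of `ℝ^ι`: the space spanned by the velocities at
`t = 0` of the smooth curves that pass through `p` at `t = 0` and lie in `Z` for small `t`. -/
def tangentSpan (Z : Set (ι → ℝ)) (p : ι → ℝ) : Submodule ℝ (ι → ℝ) :=
  Submodule.span ℝ {w | ∃ γ : ℝ → (ι → ℝ), ContDiff ℝ ∞ γ ∧ γ 0 = p ∧
    (∀ᶠ t in 𝓝 (0 : ℝ), γ t ∈ Z) ∧ deriv γ 0 = w}

/-- The pair `(p, ℓ)` consisting of a point `p` and the line `ℓ` spanned by `w ≠ 0`. -/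
def pair (p w : ι → ℝ) : ι ⊕ ι × ι → ℝ :=
  Sum.elim p fun ij => (w ⬝ᵥ w)⁻¹ * (w ij.1 * w ij.2)

/-- The bundle projection `(p, ℓ) ↦ p`. -/
def base : (ι ⊕ ι × ι → ℝ) →ₗ[ℝ] (ι → ℝ) :=
  LinearMap.funLeft ℝ ℝ Sum.inl

/-- The line `ℓ` of the pair `(p, ℓ)`: the range of the projection matrix. -/
def line (q : ι ⊕ ι × ι → ℝ) : Submodule ℝ (ι → ℝ) :=
  LinearMap.range (Matrix.mulVecLin (Matrix.of fun i j => q (Sum.inr (i, j))))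

/-- The Cartan prolongation of `(Z, Δ)`.  The new space is the projectivization of `Δ`, the set of
all `(p, ℓ)` with `p ∈ Z` and `ℓ ⊆ Δ p` a line.  The new distribution at `(p, ℓ)` consists of the
tangent vectors of the new space that project into `ℓ`. -/
def DistSpace.prolong (D : DistSpace ι) : DistSpace (ι ⊕ ι × ι) where
  carrier := {q | ∃ p ∈ D.carrier, ∃ w ∈ D.dist p, w ≠ 0 ∧ q = pair p w}
  dist q := tangentSpan {q | ∃ p ∈ D.carrier, ∃ w ∈ D.dist p, w ≠ 0 ∧ q = pair p w} q ⊓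
    (line q).comap base

end Prolongation

/-! ### The tower over `ℝ³` -/

/-- Index type of the Euclidean space in which level `k` of the tower is embedded. -/
@[reducible] def Idx : ℕ → Type
  | 0 => Fin 3
  | k + 1 => Idx k ⊕ Idx k × Idx k

instance instFintypeIdx : (k : ℕ) → Fintype (Idx k)
  | 0 => inferInstanceAs (Fintype (Fin 3))
  | k + 1 =>
    letI := instFintypeIdx k
    inferInstanceAs (Fintype (Idx k ⊕ Idx k × Idx k))

/-- The ambient Euclidean space of level `k`. -/
abbrev Amb (k : ℕ) : Type := Idx k → ℝ

/-- Level `k` of the `ℝ³`-Monster Tower, `(𝒫^k, Δ_k)`: start with `(ℝ³, Tℝ³)`, prolong `k` times. -/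
def tower : (k : ℕ) → DistSpace (Idx k)
  | 0 => { carrier := Set.univ, dist := fun _ => ⊤ }
  | k + 1 => (tower k).prolong

/-- The projection of level `k + 1` to level `k`. -/
def proj {k : ℕ} (q : Amb (k + 1)) : Amb k := base q

/-- The line `ℓ ⊆ Δ_k(p)` belonging to a point `q = (p, ℓ)` of level `k + 1`. -/
def dirOf {k : ℕ} (q : Amb (k + 1)) : Submodule ℝ (Amb k) := line q

/-- The projection of level `k` to level `0`. -/
def projZero : {k : ℕ} → Amb k → Amb 0
  | 0, p => p
  | _ + 1, q => projZero (proj q)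

/-- The fiber of `𝒫^(k+1) → 𝒫^k` over `p`. -/
def fiber {k : ℕ} (p : Amb k) : Set (Amb (k + 1)) :=
  {q | q ∈ (tower (k + 1)).carrier ∧ proj q = p}

/-! ### Baby Monsters and critical planes -/

/-- The levels, inside level `k` of the tower, of all Baby Monsters.  A Baby Monster starts with
a fiber `F` of `𝒫^i → 𝒫^(i-1)`, `i ≥ 1`, together with its tangent bundle; its further levels are the
iterated prolongations of `(F, TF)`. -/
def babyMonsters : (k : ℕ) → Set (DistSpace (Idx k))
  | 0 => ∅
  | k + 1 =>
    {B | ∃ p ∈ (tower k).carrier, B = { carrier := fiber p, dist := tangentSpan (fiber p) }} ∪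
      {B | ∃ B' ∈ babyMonsters k, B = B'.prolong}

/-- `H` is a critical plane through the point `p` of level `k`. -/
def IsCriticalPlane {k : ℕ} (p : Amb k) (H : Submodule ℝ (Amb k)) : Prop :=
  ∃ B ∈ babyMonsters k, p ∈ B.carrier ∧ H = B.dist p

/-- `H` is the vertical plane at the point `p`, the tangent space of the fiber through `p`
(there is none at level `0`). -/
def IsVerticalPlane : {k : ℕ} → Amb k → Submodule ℝ (Amb k) → Prop
  | 0, _, _ => False
  | _ + 1, p, H => H = tangentSpan (fiber (proj p)) p

/-! ### Kumpera-Rubin coordinates -/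

/-- Index type of the Kumpera-Rubin coordinates `(x, y, z, u₁, v₁, …, u_k, v_k)`. -/
@[reducible] def KRIdx : ℕ → Type
  | 0 => Fin 3
  | k + 1 => KRIdx k ⊕ Fin 2

instance instFintypeKRIdx : (k : ℕ) → Fintype (KRIdx k)
  | 0 => inferInstanceAs (Fintype (Fin 3))
  | k + 1 =>
    letI := instFintypeKRIdx k
    inferInstanceAs (Fintype (KRIdx k ⊕ Fin 2))

instance instDecidableEqKRIdx : (k : ℕ) → DecidableEq (KRIdx k)
  | 0 => inferInstanceAs (DecidableEq (Fin 3))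
  | k + 1 =>
    letI := instDecidableEqKRIdx k
    inferInstanceAs (DecidableEq (KRIdx k ⊕ Fin 2))

/-- The domain `ℝ^(3+2k)` of a Kumpera-Rubin chart. -/
abbrev KRSpace (k : ℕ) : Type := KRIdx k → ℝ

/-- The frame of `Δ_k`, in Kumpera-Rubin coordinates, dual to the coframing `[df_k : du_k : dv_k]`
(which is `[dx : dy : dz]` at level `0`).

The sequence `c` selects the chart: `c k` is the position, in the coframing of `Δ_k`, of the covector
by which one divides to get from level `k` to level `k + 1`.  That covector becomes `df_(k+1)`, and
`u_(k+1)`, `v_(k+1)` are the quotients of the other two by it, in their order.  Hence at a point with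
last coordinates `(u, v)` the line from the level below is spanned by `e_j + u e_l + v e_m`,
where `j = c k` and `l < m` are the other two positions. -/
def krFrame (c : ℕ → Fin 3) : (k : ℕ) → Fin 3 → KRSpace k → KRSpace k
  | 0, i, _ => Pi.single i 1
  | k + 1, i, x =>
    Fin.cases
      (motive := fun _ => KRSpace (k + 1))
      (Sum.elim
        (krFrame c k (c k) (x ∘ Sum.inl) +
          ∑ m : Fin 2, x (Sum.inr m) • krFrame c k ((c k).succAbove m) (x ∘ Sum.inl))
        0)
      (fun m => Pi.single (Sum.inr m) 1) i

/-- The parametrization of the part of level `k` covered by the Kumpera-Rubin chart `c`: it sends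
coordinates to the point of the tower that has these coordinates. -/
def krPoint (c : ℕ → Fin 3) : (k : ℕ) → KRSpace k → Amb k
  | 0, x => x
  | k + 1, x =>
    pair (krPoint c k (x ∘ Sum.inl))
      (fderiv ℝ (krPoint c k) (x ∘ Sum.inl)
        (krFrame c k (c k) (x ∘ Sum.inl) +
          ∑ m : Fin 2, x (Sum.inr m) • krFrame c k ((c k).succAbove m) (x ∘ Sum.inl)))

/-- The convention for the choice of the chart at a given point: at every level one divides by
the first covector among `df, du, dv` (in this order) that does not vanish on the given line;
in other words, the quotients of the covectors that precede the divisor are zero at the point. -/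
def IsAdapted (c : ℕ → Fin 3) : (k : ℕ) → KRSpace k → Prop
  | 0, _ => True
  | k + 1, x => IsAdapted c k (x ∘ Sum.inl) ∧
      ∀ m : Fin 2, (c k).succAbove m < c k → x (Sum.inr m) = 0

/-- The plane in `Δ_k` on which the `i`-th covector of the coframing `[df_k : du_k : dv_k]` vanishes,
at the point with coordinates `x`. -/
def krPlane (c : ℕ → Fin 3) (k : ℕ) (x : KRSpace k) (i : Fin 3) : Submodule ℝ (Amb k) :=
  Submodule.span ℝ {w | ∃ n : Fin 3, n ≠ i ∧ w = fderiv ℝ (krPoint c k) x (krFrame c k n x)}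

/-- `H` is the tangency plane `T_i` (`i = 1, 2`) at the point `p`: a critical plane which in
the Kumpera-Rubin coframing `[df : du : dv]` at `p` is `[a : 0 : b]` if `i = 1`, and `[a : b : 0]` if
`i = 2`. -/
def IsTangencyPlane {k : ℕ} (i : Fin 3) (p : Amb k) (H : Submodule ℝ (Amb k)) : Prop :=
  IsCriticalPlane p H ∧
    ∃ (c : ℕ → Fin 3) (x : KRSpace k), IsAdapted c k x ∧ krPoint c k x = p ∧ H = krPlane c k x i

/-! ### RVT codes -/

/-- The line `ℓ` at the point `p` is a critical direction: some immersed integral curve of `Δ_k`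
through `p` is tangent to `ℓ` and projects to a constant curve in `ℝ³`. -/
def IsCriticalDirection {k : ℕ} (p : Amb k) (l : Submodule ℝ (Amb k)) : Prop :=
  ∃ γ : ℝ → Amb k, ContDiff ℝ ∞ γ ∧ γ 0 = p ∧ deriv γ 0 ≠ 0 ∧ deriv γ 0 ∈ l ∧
    ∀ᶠ t in 𝓝 (0 : ℝ), γ t ∈ (tower k).carrier ∧ deriv γ t ∈ (tower k).dist (γ t) ∧
      projZero (γ t) = projZero p

inductive Letter
  | R | V | T₁ | T₂ | L₁ | L₂ | L₃

/-- The line `ℓ` lies in the vertical plane at `p`. -/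
def InV {k : ℕ} (p : Amb k) (l : Submodule ℝ (Amb k)) : Prop :=
  ∃ H, IsVerticalPlane p H ∧ l ≤ H

/-- The tangency plane `T_i` exists at `p`, and the line `ℓ` lies in it. -/
def InT {k : ℕ} (i : Fin 3) (p : Amb k) (l : Submodule ℝ (Amb k)) : Prop :=
  ∃ H, IsTangencyPlane i p H ∧ l ≤ H

/-- `HasLetter q X`: the point `q = (p, ℓ)` of level `k + 1` has the letter `X`.  It is `R` for a regular
direction `ℓ`.  For a critical direction it tells which of the critical planes `V`, `T₁`, `T₂`, or
which of the lines `L₁ = V ∩ T₁`, `L₂ = T₁ ∩ T₂`, `L₃ = V ∩ T₂`, contains `ℓ`. -/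
def HasLetter {k : ℕ} (q : Amb (k + 1)) : Letter → Prop
  | .R => ¬ IsCriticalDirection (proj q) (dirOf q)
  | .V => IsCriticalDirection (proj q) (dirOf q) ∧
      InV (proj q) (dirOf q) ∧ ¬ InT 1 (proj q) (dirOf q) ∧ ¬ InT 2 (proj q) (dirOf q)
  | .T₁ => IsCriticalDirection (proj q) (dirOf q) ∧
      ¬ InV (proj q) (dirOf q) ∧ InT 1 (proj q) (dirOf q) ∧ ¬ InT 2 (proj q) (dirOf q)
  | .T₂ => IsCriticalDirection (proj q) (dirOf q) ∧
      ¬ InV (proj q) (dirOf q) ∧ ¬ InT 1 (proj q) (dirOf q) ∧ InT 2 (proj q) (dirOf q)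
  | .L₁ => IsCriticalDirection (proj q) (dirOf q) ∧
      InV (proj q) (dirOf q) ∧ InT 1 (proj q) (dirOf q)
  | .L₂ => IsCriticalDirection (proj q) (dirOf q) ∧
      InT 1 (proj q) (dirOf q) ∧ InT 2 (proj q) (dirOf q)
  | .L₃ => IsCriticalDirection (proj q) (dirOf q) ∧
      InV (proj q) (dirOf q) ∧ InT 2 (proj q) (dirOf q)

/-- `s` is the RVT code of the point `p` of level `k`: its `i`-th letter is the letter of the projection
of `p` to level `i`. -/
def HasCode : {k : ℕ} → Amb k → List Letter → Prop
  | 0, _, s => s = []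
  | _ + 1, q, s => ∃ s' X, s = s' ++ [X] ∧ HasCode (proj q) s' ∧ HasLetter q X

/-- The letters that the spelling rules allow after a given letter. -/
def allowedAfter : Letter → Set Letter
  | .R => {.R, .V}
  | .V => {.R, .V, .T₁, .L₁}
  | .T₁ => {.R, .V, .T₁, .L₁}
  | .L₁ => {.R, .V, .T₁, .T₂, .L₁, .L₂, .L₃}
  | .L₂ => {.R, .V, .T₁, .T₂, .L₁, .L₂, .L₃}
  | .L₃ => {.R, .V, .T₁, .T₂, .L₁, .L₂, .L₃}
  | .T₂ => {.R, .V, .T₂, .L₃}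

end Monster

end

/-! In Kumpera-Rubin coordinates the spelling rules become finite combinatorics. The critical planes
at a point are coordinate planes of the coframing `[df : du : dv]`, recorded by the set `critPos` of
their positions. Position `0`, the vertical plane, is critical at every level `k ≥ 1`. Any other
critical plane at `(p, ℓ)` comes from a critical plane at `p` that contains `ℓ`; its new position is
that of the quotient formed from its covector (`isCriticalPlane_iff`). A direction is critical
exactly when it lies in some critical plane (`isCriticalDirection_iff`).

Each point has one adapted coordinate description (`exists_adapted`, `adapted_unique`), so `T₁` and
`T₂` are unambiguous. The letter of `ℓ` records the critical positions at which the coefficients of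
`ℓ` vanish (`hasLetter_iff`). Since `ℓ` is not zero, this is a proper subset of the three positions,
and the seven proper subsets match the seven letters.

In an adapted chart the divisor is the first nonzero coefficient of `ℓ`. Hence the letter alone
determines the critical planes one level up (`critPos_of_hasLetter`): `V` after `R`; `V, T₁` after
`V` or `T₁`; `V, T₂` after `T₂`; all three after an `L`. Every proper subset of the positions is the
zero set of some direction (`exists_hasLetter`), so the letters that may follow are those whose
planes are all available. Level `0` has no critical planes, which forces the initial `R`.

The geometric foundation is that charts, and the subsets with distributions described in them,
survive prolongation (`Coords.next`, `SubChart.next`). -/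

noncomputable section

namespace Monster

/-! ### Lines as projection matrices -/

section Pair
variable {ι : Type} [Fintype ι]

@[simp] lemma base_pair (p w : ι → ℝ) : base (pair p w) = p := rfl

lemma pair_smul (p w : ι → ℝ) {s : ℝ} (hs : s ≠ 0) : pair p (s • w) = pair p w := by
  funext a
  rcases a with a | ⟨a, b⟩
  · rfl
  · simp only [pair, Sum.elim_inr, smul_dotProduct, dotProduct_smul, smul_eq_mul, Pi.smul_apply]
    rw [mul_inv, mul_inv]
    field_simp

lemma pair_mulVec (p w v : ι → ℝ) :
    (fun a => ∑ b, pair p w (Sum.inr (a, b)) * v b) = ((w ⬝ᵥ w)⁻¹ * (w ⬝ᵥ v)) • w := by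
  funext a
  simp only [pair, Sum.elim_inr, Pi.smul_apply, smul_eq_mul, dotProduct, Finset.mul_sum,
    Finset.sum_mul]
  exact Finset.sum_congr rfl fun b _ => by ring

lemma line_pair (p : ι → ℝ) {w : ι → ℝ} (hw : w ≠ 0) :
    line (pair p w) = Submodule.span ℝ {w} := by
  have key : ∀ v, Matrix.mulVecLin (Matrix.of fun i j => pair p w (Sum.inr (i, j))) v =
      ((w ⬝ᵥ w)⁻¹ * (w ⬝ᵥ v)) • w := fun v => pair_mulVec p w v
  have hw' : w ⬝ᵥ w ≠ 0 := fun h => hw (dotProduct_self_eq_zero.1 h)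
  apply le_antisymm
  · rintro _ ⟨v, rfl⟩
    rw [key]
    exact Submodule.smul_mem _ _ (Submodule.mem_span_singleton_self w)
  · rw [Submodule.span_singleton_le_iff_mem]
    refine ⟨w, ?_⟩
    rw [key, inv_mul_cancel₀ hw', one_smul]

lemma pair_eq_pair_iff {p w p' w' : ι → ℝ} (hw : w ≠ 0) (hw' : w' ≠ 0) :
    pair p w = pair p' w' ↔ p = p' ∧ ∃ s : ℝ, s ≠ 0 ∧ w' = s • w := by
  constructor
  · intro h
    refine ⟨by simpa using congrArg base h, ?_⟩
    have h2 : w' ∈ line (pair p w) := by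
      rw [h, line_pair _ hw']
      exact Submodule.mem_span_singleton_self _
    rw [line_pair _ hw, Submodule.mem_span_singleton] at h2
    obtain ⟨s, rfl⟩ := h2
    exact ⟨s, fun hs => hw' (by rw [hs, zero_smul]), rfl⟩
  · rintro ⟨rfl, s, hs, rfl⟩
    rw [pair_smul _ _ hs]

lemma contDiff_base : ContDiff ℝ ∞ (base : (ι ⊕ ι × ι → ℝ) → (ι → ℝ)) :=
  (LinearMap.toContinuousLinearMap (base : (ι ⊕ ι × ι → ℝ) →ₗ[ℝ] (ι → ℝ))).contDiff

lemma contDiff_pair {E : Type*} [NormedAddCommGroup E] [NormedSpace ℝ E] {f g : E → ι → ℝ}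
    (hf : ContDiff ℝ ∞ f) (hg : ContDiff ℝ ∞ g) (h0 : ∀ x, g x ≠ 0) :
    ContDiff ℝ ∞ fun x => pair (f x) (g x) := by
  rw [contDiff_pi] at hf hg ⊢
  rintro (a | ⟨a, b⟩)
  · exact hf a
  · refine ContDiff.mul (ContDiff.inv ?_ fun x h => h0 x (dotProduct_self_eq_zero.1 h))
      ((hg a).mul (hg b))
    exact ContDiff.sum fun i _ => (hg i).mul (hg i)

end Pair

/-! ### Coefficients with respect to independent families -/

/-- Turns membership in a plane spanned by part of a frame into the vanishing of coefficients; all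
later plane incidences are read off this way. -/
lemma sum_smul_mem_span_image_iff {E : Type*} [AddCommGroup E] [Module ℝ E] {v : Fin 3 → E}
    (hv : LinearIndependent ℝ v) (J : Set (Fin 3)) (a : Fin 3 → ℝ) :
    ∑ i, a i • v i ∈ Submodule.span ℝ (v '' J) ↔ ∀ i, i ∉ J → a i = 0 := by
  constructor
  · intro h i hi
    obtain ⟨l, hl, hl'⟩ := (Finsupp.mem_span_image_iff_linearCombination ℝ).1 h
    have h1 : Finsupp.linearCombination ℝ v (Finsupp.equivFunOnFinite.symm a) =
        ∑ i, a i • v i := by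
      rw [Finsupp.linearCombination_apply, Finsupp.sum_fintype _ _ fun i => zero_smul ℝ (v i)]
      rfl
    have h2 : l = Finsupp.equivFunOnFinite.symm a := hv (by rw [hl', h1])
    have h3 : l i = 0 := by
      by_contra h0
      exact hi (hl (Finsupp.mem_support_iff.2 h0))
    rw [h2] at h3
    exact h3
  · intro h
    refine Submodule.sum_mem _ fun i _ => ?_
    by_cases hi : i ∈ J
    · exact Submodule.smul_mem _ _ (Submodule.subset_span ⟨i, hi, rfl⟩)
    · rw [h i hi, zero_smul]
      exact Submodule.zero_mem _

lemma exists_coeff_of_mem_span_image {E : Type*} [AddCommGroup E] [Module ℝ E] {v : Fin 3 → E}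
    {J : Set (Fin 3)} {w : E} (h : w ∈ Submodule.span ℝ (v '' J)) :
    ∃ a : Fin 3 → ℝ, (∀ i, i ∉ J → a i = 0) ∧ w = ∑ i, a i • v i := by
  obtain ⟨l, hl, rfl⟩ := (Finsupp.mem_span_image_iff_linearCombination ℝ).1 h
  refine ⟨l, fun i hi => ?_, ?_⟩
  · by_contra h0
    exact hi (hl (Finsupp.mem_support_iff.2 h0))
  · rw [Finsupp.linearCombination_apply, Finsupp.sum_fintype _ _ fun i => zero_smul ℝ (v i)]

/-! ### One step of the Kumpera-Rubin construction -/

section Step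
variable {ι α : Type}

/-- Restriction of coordinates to the level below. -/
def lower : (α ⊕ Fin 2 → ℝ) →L[ℝ] (α → ℝ) :=
  ContinuousLinearMap.pi fun i => ContinuousLinearMap.proj (Sum.inl i)

@[simp] lemma lower_apply (x : α ⊕ Fin 2 → ℝ) : lower x = x ∘ Sum.inl := rfl

/-- Coefficients, in the frame of the level below, of the direction with affine coordinates
`x (inr 0)`, `x (inr 1)`, where position `j` is the divisor. -/
def dirCoeff (j : Fin 3) (x : α ⊕ Fin 2 → ℝ) : Fin 3 → ℝ :=
  j.insertNth (α := fun _ => ℝ) 1 (x ∘ Sum.inr)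

@[simp] lemma dirCoeff_self (j : Fin 3) (x : α ⊕ Fin 2 → ℝ) : dirCoeff j x j = 1 := by
  simp [dirCoeff]

@[simp] lemma dirCoeff_succAbove (j : Fin 3) (x : α ⊕ Fin 2 → ℝ) (m : Fin 2) :
    dirCoeff j x (j.succAbove m) = x (Sum.inr m) := by
  simp [dirCoeff]

/-- The vector in the frame `e` with coefficients `dirCoeff`. -/
def dirVec (j : Fin 3) (e : Fin 3 → (α → ℝ) → (α → ℝ)) (x : α ⊕ Fin 2 → ℝ) : α → ℝ :=
  e j (x ∘ Sum.inl) + ∑ m : Fin 2, x (Sum.inr m) • e (j.succAbove m) (x ∘ Sum.inl)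

lemma dirVec_eq (j : Fin 3) (e : Fin 3 → (α → ℝ) → (α → ℝ)) (x : α ⊕ Fin 2 → ℝ) :
    dirVec j e x = ∑ i, dirCoeff j x i • e i (x ∘ Sum.inl) := by
  rw [Fin.sum_univ_succAbove _ j]
  simp [dirVec]

/-- The frame of the next level. -/
def nextFrame (j : Fin 3) (e : Fin 3 → (α → ℝ) → (α → ℝ)) (i : Fin 3) (x : α ⊕ Fin 2 → ℝ) :
    α ⊕ Fin 2 → ℝ :=
  Fin.cases (motive := fun _ => α ⊕ Fin 2 → ℝ) (Sum.elim (dirVec j e x) 0)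
    (fun m => Sum.elim 0 (Pi.single m 1)) i

lemma sum_smul_nextFrame (j : Fin 3) (e : Fin 3 → (α → ℝ) → (α → ℝ)) (a : Fin 3 → ℝ)
    (x : α ⊕ Fin 2 → ℝ) :
    ∑ i, a i • nextFrame j e i x = Sum.elim (a 0 • dirVec j e x) (fun m => a m.succ) := by
  rw [Fin.sum_univ_succ]
  funext b
  rcases b with b | b
  · simp [nextFrame]
  · fin_cases b <;> simp [nextFrame]

lemma fderiv_dirVec_eq (φ : (α → ℝ) → (ι → ℝ)) (e : Fin 3 → (α → ℝ) → (α → ℝ))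
    (j : Fin 3) (x : α ⊕ Fin 2 → ℝ) :
    fderiv ℝ φ (x ∘ Sum.inl) (dirVec j e x) =
      ∑ i, dirCoeff j x i • fderiv ℝ φ (x ∘ Sum.inl) (e i (x ∘ Sum.inl)) := by
  rw [dirVec_eq, map_sum]
  simp only [map_smul]

variable [Fintype α]

/-- The parametrization of the next level. -/
def nextMap [Fintype ι] (j : Fin 3) (e : Fin 3 → (α → ℝ) → (α → ℝ)) (φ : (α → ℝ) → (ι → ℝ))
    (x : α ⊕ Fin 2 → ℝ) : ι ⊕ ι × ι → ℝ :=
  pair (φ (x ∘ Sum.inl)) (fderiv ℝ φ (x ∘ Sum.inl) (dirVec j e x))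

variable [Fintype ι]

/-- `φ` parametrizes an open part of `C`, has a smooth left inverse, and `e` is a smooth frame
with a smooth dual coframe. -/
structure Coords (C : Set (ι → ℝ)) (φ : (α → ℝ) → (ι → ℝ))
    (e : Fin 3 → (α → ℝ) → (α → ℝ)) : Prop where
  smooth : ContDiff ℝ ∞ φ
  smooth_frame : ∀ i, ContDiff ℝ ∞ (e i)
  coframe : ∃ θ : Fin 3 → (α → ℝ) → ((α → ℝ) →L[ℝ] ℝ), (∀ i, ContDiff ℝ ∞ (θ i)) ∧
    ∀ x i l, θ i x (e l x) = if i = l then 1 else 0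
  inverse : ∃ (ψ : (ι → ℝ) → (α → ℝ)) (U : Set (ι → ℝ)), IsOpen U ∧ ContDiffOn ℝ ∞ ψ U ∧
    (∀ x, φ x ∈ U) ∧ (∀ x, ψ (φ x) = x) ∧ ∀ p ∈ C, p ∈ U → φ (ψ p) = p
  mem : ∀ x, φ x ∈ C

lemma fderiv_comp_fderiv_of_leftInverse {φ : (α → ℝ) → (ι → ℝ)} {ψ : (ι → ℝ) → (α → ℝ)}
    {U : Set (ι → ℝ)} (hφ : ContDiff ℝ ∞ φ) (hU : IsOpen U) (hψ : ContDiffOn ℝ ∞ ψ U)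
    (hm : ∀ x, φ x ∈ U) (hl : ∀ x, ψ (φ x) = x) (x y : α → ℝ) :
    fderiv ℝ ψ (φ x) (fderiv ℝ φ x y) = y := by
  have h1 : DifferentiableAt ℝ ψ (φ x) :=
    (hψ.contDiffAt (hU.mem_nhds (hm x))).differentiableAt (by simp)
  have h2 : DifferentiableAt ℝ φ x := hφ.contDiffAt.differentiableAt (by simp)
  have h3 := fderiv_comp x h1 h2
  have h4 : ψ ∘ φ = id := funext hl
  rw [h4, fderiv_id] at h3
  have := congrArg (fun L => L y) h3
  simpa using this.symm

section
variable {C : Set (ι → ℝ)} {φ : (α → ℝ) → (ι → ℝ)} {e : Fin 3 → (α → ℝ) → (α → ℝ)}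

lemma Coords.fderiv_injective (h : Coords C φ e) (x : α → ℝ) :
    Function.Injective (fderiv ℝ φ x) := by
  obtain ⟨ψ, U, hU, hψ, hm, hl, -⟩ := h.inverse
  exact Function.LeftInverse.injective
    (g := fderiv ℝ ψ (φ x)) (fderiv_comp_fderiv_of_leftInverse h.smooth hU hψ hm hl x)

lemma Coords.injective (h : Coords C φ e) : Function.Injective φ := by
  obtain ⟨ψ, U, hU, hψ, hm, hl, -⟩ := h.inverse
  exact Function.LeftInverse.injective hl

lemma Coords.linearIndependent_frame (h : Coords C φ e) (x : α → ℝ) :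
    LinearIndependent ℝ fun i => e i x := by
  obtain ⟨θ, -, hθ⟩ := h.coframe
  rw [Fintype.linearIndependent_iff]
  intro a ha i
  have := congrArg (θ i x) ha
  simpa [map_sum, hθ] using this

lemma Coords.linearIndependent (h : Coords C φ e) (x : α → ℝ) :
    LinearIndependent ℝ fun i => fderiv ℝ φ x (e i x) :=
  (h.linearIndependent_frame x).map' (fderiv ℝ φ x).toLinearMap
    (LinearMap.ker_eq_bot.2 (h.fderiv_injective x))

lemma Coords.dirVec_ne_zero (h : Coords C φ e) (j : Fin 3) (x : α ⊕ Fin 2 → ℝ) :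
    dirVec j e x ≠ 0 := by
  intro h0
  rw [dirVec_eq] at h0
  have := Fintype.linearIndependent_iff.1 (h.linearIndependent_frame (x ∘ Sum.inl)) _ h0 j
  simp at this

lemma Coords.fderiv_dirVec_ne_zero (h : Coords C φ e) (j : Fin 3) (x : α ⊕ Fin 2 → ℝ) :
    fderiv ℝ φ (x ∘ Sum.inl) (dirVec j e x) ≠ 0 := fun h0 =>
  h.dirVec_ne_zero j x (h.fderiv_injective _ (by rw [h0, map_zero]))

lemma contDiff_lower {n : WithTop ℕ∞} :
    ContDiff ℝ n (fun x : α ⊕ Fin 2 → ℝ => x ∘ Sum.inl) :=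
  (lower (α := α)).contDiff

lemma contDiff_dirVec (he : ∀ i, ContDiff ℝ ∞ (e i)) (j : Fin 3) :
    ContDiff ℝ ∞ (dirVec j e) := by
  refine ((he j).comp contDiff_lower).add (ContDiff.sum fun m _ => ?_)
  exact (contDiff_apply ℝ ℝ (Sum.inr m)).smul ((he _).comp contDiff_lower)

lemma contDiff_sumElim {E : Type*} [NormedAddCommGroup E] [NormedSpace ℝ E] {n : WithTop ℕ∞}
    {f : E → α → ℝ} {g : E → Fin 2 → ℝ} (hf : ContDiff ℝ n f) (hg : ContDiff ℝ n g) :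
    ContDiff ℝ n fun x => (Sum.elim (f x) (g x) : α ⊕ Fin 2 → ℝ) := by
  rw [contDiff_pi] at hf hg ⊢
  rintro (a | a)
  · exact hf a
  · exact hg a

lemma contDiff_nextFrame (he : ∀ i, ContDiff ℝ ∞ (e i)) (j i : Fin 3) :
    ContDiff ℝ ∞ (nextFrame j e i) := by
  refine Fin.cases ?_ (fun m => ?_) i
  · exact contDiff_sumElim (contDiff_dirVec he j) contDiff_const
  · exact contDiff_const

lemma Coords.smooth_nextMap (h : Coords C φ e) (j : Fin 3) : ContDiff ℝ ∞ (nextMap j e φ) :=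
  contDiff_pair (h.smooth.comp contDiff_lower)
    (((h.smooth.fderiv_right (m := ∞) (by simp)).comp contDiff_lower).clm_apply
      (contDiff_dirVec h.smooth_frame j))
    (h.fderiv_dirVec_ne_zero j)

lemma Coords.coframe_next (h : Coords C φ e) (j : Fin 3) :
    ∃ θ : Fin 3 → (α ⊕ Fin 2 → ℝ) → ((α ⊕ Fin 2 → ℝ) →L[ℝ] ℝ), (∀ i, ContDiff ℝ ∞ (θ i)) ∧
      ∀ x i l, θ i x (nextFrame j e l x) = if i = l then 1 else 0 := by
  obtain ⟨θ, hs, hθ⟩ := h.coframe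
  -- The new `df` is the pullback of the divisor covector, equal to `1` on `dirVec` because the
  -- `j`-th coefficient is `1`; the new `du`, `dv` are the differentials of the two fiber
  -- coordinates.
  refine ⟨fun i x => Fin.cases (motive := fun _ => (α ⊕ Fin 2 → ℝ) →L[ℝ] ℝ)
    ((θ j (x ∘ Sum.inl)).comp lower) (fun m => ContinuousLinearMap.proj (Sum.inr m)) i, ?_, ?_⟩
  · intro i
    refine Fin.cases ?_ (fun m => ?_) i
    · exact ((hs j).comp contDiff_lower).clm_comp contDiff_const
    · exact contDiff_const
  · intro x i l
    refine Fin.cases ?_ (fun m => ?_) i <;> refine Fin.cases ?_ (fun m' => ?_) l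
    · have : lower (nextFrame j e 0 x) = dirVec j e x := rfl
      simp only [Fin.cases_zero, ContinuousLinearMap.comp_apply, this, dirVec_eq, map_sum,
        map_smul, hθ]
      simp
    · have : lower (nextFrame j e m'.succ x) = 0 := by
        funext a
        simp [nextFrame]
      simp [this, (Fin.succ_ne_zero m').symm]
    · simp [nextFrame, Fin.succ_ne_zero]
    · simp [nextFrame, Pi.single_apply]

end
end Step

/-! ### The next chart and its smooth inverse -/

section Step
variable {ι α : Type}
variable {φ : (α → ℝ) → (ι → ℝ)} {e : Fin 3 → (α → ℝ) → (α → ℝ)}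

/-- The distribution of `D` is spanned by the image of the frame `e` along the parametrization. -/
def Spans (D : DistSpace ι) (φ : (α → ℝ) → (ι → ℝ)) (e : Fin 3 → (α → ℝ) → (α → ℝ)) : Prop :=
  ∀ x, D.dist (φ x) = Submodule.span ℝ ((fun i => fderiv ℝ φ x (e i x)) '' Set.univ)

lemma Spans.exists_coeff {D : DistSpace ι} (hD : Spans D φ e) {x : α → ℝ}
    {w : ι → ℝ} (hw : w ∈ D.dist (φ x)) :
    ∃ a : Fin 3 → ℝ, w = fderiv ℝ φ x (∑ i, a i • e i x) := by
  rw [hD] at hw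
  obtain ⟨a, -, rfl⟩ := exists_coeff_of_mem_span_image hw
  exact ⟨a, by simp [map_sum]⟩

variable [Fintype ι]

/-- A direction with nonzero `j`-th coefficient is represented in the next chart. -/
lemma nextMap_of_coeff (φ : (α → ℝ) → (ι → ℝ)) (e : Fin 3 → (α → ℝ) → (α → ℝ))
    (x : α → ℝ) (a : Fin 3 → ℝ) (j : Fin 3) (h : a j ≠ 0) :
    pair (φ x) (fderiv ℝ φ x (∑ i, a i • e i x)) =
      nextMap j e φ (Sum.elim x fun m => a (j.succAbove m) / a j) := by
  have : ∑ i, a i • e i x =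
      a j • dirVec j e (Sum.elim x fun m => a (j.succAbove m) / a j) := by
    rw [Fin.sum_univ_succAbove _ j, dirVec, smul_add, Finset.smul_sum]
    congr 1
    refine Finset.sum_congr rfl fun m _ => ?_
    rw [smul_smul, Sum.elim_inr, mul_div_cancel₀ _ h]
    rfl
  rw [this, map_smul, pair_smul _ _ h]
  rfl

variable [Fintype α]

/-- The delicate point is a smooth left inverse on an open set: a point of the prolongation gives
only a projection matrix, not a spanning vector. Applying the matrix to a suitable vector produces a
spanning vector, whose coefficient ratios are the affine coordinates. -/
lemma Coords.next {D : DistSpace ι} (h : Coords D.carrier φ e) (hD : Spans D φ e) (j : Fin 3) :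
    Coords D.prolong.carrier (nextMap j e φ) (nextFrame j e) where
  smooth := h.smooth_nextMap j
  smooth_frame := contDiff_nextFrame h.smooth_frame j
  coframe := h.coframe_next j
  mem x := by
    refine ⟨_, h.mem _, _, ?_, h.fderiv_dirVec_ne_zero j x, rfl⟩
    rw [hD, fderiv_dirVec_eq]
    exact (sum_smul_mem_span_image_iff (h.linearIndependent _) _ _).2 fun i hi =>
      absurd (Set.mem_univ i) hi
  inverse := by
    classical
    obtain ⟨ψ, U, hU, hψ, hm, hl, hC⟩ := h.inverse
    obtain ⟨θ, hθs, hθ⟩ := h.coframe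
    -- `A` represents the covector `θ j` pulled back by `ψ`. The projection onto the line of `w`
    -- sends it to a multiple of `w` that is nonzero exactly when the `j`-th coefficient of `w` is
    -- nonzero. `N i` is the `i`-th coefficient of that multiple.
    let A : (ι → ℝ) → ι → ℝ := fun p b => θ j (ψ p) (fderiv ℝ ψ p (Pi.single b 1))
    let v : (ι ⊕ ι × ι → ℝ) → ι → ℝ := fun q a => ∑ b, q (Sum.inr (a, b)) * A (base q) b
    let N : Fin 3 → (ι ⊕ ι × ι → ℝ) → ℝ := fun i q =>
      θ i (ψ (base q)) (fderiv ℝ ψ (base q) (v q))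
    have hb : Set.MapsTo base ((base : (ι ⊕ ι × ι → ℝ) → (ι → ℝ)) ⁻¹' U) U := fun _ hq => hq
    have hbs : ContDiffOn ℝ ∞ (base : (ι ⊕ ι × ι → ℝ) → (ι → ℝ)) (base ⁻¹' U) :=
      contDiff_base.contDiffOn
    have hψ' : ContDiffOn ℝ ∞ (fderiv ℝ ψ) U := hψ.fderiv_of_isOpen hU (by simp)
    have hθψ : ∀ i, ContDiffOn ℝ ∞ (fun p => θ i (ψ p)) U := fun i => (hθs i).comp_contDiffOn hψ
    have hA : ∀ b, ContDiffOn ℝ ∞ (fun p => A p b) U := fun b =>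
      (hθψ j).clm_apply (hψ'.clm_apply contDiffOn_const)
    have hv : ContDiffOn ℝ ∞ v (base ⁻¹' U) := by
      refine contDiffOn_pi.2 fun a => ContDiffOn.sum fun b _ => ?_
      exact (contDiff_apply ℝ ℝ _).contDiffOn.mul ((hA b).comp hbs hb)
    have hN : ∀ i, ContDiffOn ℝ ∞ (N i) (base ⁻¹' U) := fun i =>
      ((hθψ i).comp hbs hb).clm_apply ((hψ'.comp hbs hb).clm_apply hv)
    have hUb : IsOpen ((base : (ι ⊕ ι × ι → ℝ) → (ι → ℝ)) ⁻¹' U) :=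
      hU.preimage contDiff_base.continuous
    -- All the `N i` share the factor `s = (w ⬝ᵥ w)⁻¹ * a j`, which cancels in the quotients `N i /
    -- N j`.
    have hNpair : ∀ (x : α → ℝ) (a : Fin 3 → ℝ), ∃ s : ℝ, s * a j = (fderiv ℝ φ x (∑ i, a i • e i x) ⬝ᵥ
        fderiv ℝ φ x (∑ i, a i • e i x))⁻¹ * (a j * a j) ∧
        ∀ i, N i (pair (φ x) (fderiv ℝ φ x (∑ i, a i • e i x))) = s * a i := by
      intro x a
      set w := fderiv ℝ φ x (∑ i, a i • e i x) with hw
      have hψw : fderiv ℝ ψ (φ x) w = ∑ i, a i • e i x :=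
        fderiv_comp_fderiv_of_leftInverse h.smooth hU hψ hm hl _ _
      have hθw : ∀ i, θ i x (∑ l, a l • e l x) = a i := by
        intro i
        simp [map_sum, hθ]
      have hAw : w ⬝ᵥ A (φ x) = a j := by
        have h1 : w = ∑ b, w b • (Pi.single b 1 : ι → ℝ) := by
          funext c
          simp [Finset.sum_apply, Pi.single_apply]
        have h2 : θ j (ψ (φ x)) (fderiv ℝ ψ (φ x) w) = a j := by rw [hψw, hl, hθw]
        rw [← h2]
        conv_rhs => rw [h1]
        simp only [map_sum, map_smul, smul_eq_mul, dotProduct, A]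
      have hvw : v (pair (φ x) w) = ((w ⬝ᵥ w)⁻¹ * a j) • w := by
        rw [← hAw]
        exact pair_mulVec _ _ _
      refine ⟨(w ⬝ᵥ w)⁻¹ * a j, by ring, fun i => ?_⟩
      simp only [N, base_pair, hvw, map_smul, hψw, hl, hθw, smul_eq_mul]
    refine ⟨fun q => Sum.elim (ψ (base q)) fun m => N (j.succAbove m) q / N j q,
      base ⁻¹' U ∩ N j ⁻¹' {0}ᶜ, ?_, ?_, ?_, ?_, ?_⟩
    · exact (hN j).continuousOn.isOpen_inter_preimage hUb isOpen_compl_singleton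
    · refine contDiffOn_pi.2 ?_
      rintro (a | m)
      · exact (contDiffOn_pi.1 (hψ.comp (hbs.mono Set.inter_subset_left)
          (hb.mono_left Set.inter_subset_left))) a
      · exact ((hN _).mono Set.inter_subset_left).div ((hN j).mono Set.inter_subset_left)
          fun q hq => hq.2
    · intro x
      refine ⟨hm _, ?_⟩
      obtain ⟨s, hs, hNs⟩ := hNpair (x ∘ Sum.inl) (dirCoeff j x)
      rw [← dirVec_eq] at hs hNs
      have hne : fderiv ℝ φ (x ∘ Sum.inl) (dirVec j e x) ≠ 0 := h.fderiv_dirVec_ne_zero j x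
      simp only [Set.mem_preimage, Set.mem_compl_iff, Set.mem_singleton_iff, nextMap, hNs]
      rw [hs, dirCoeff_self]
      simpa using hne
    · intro x
      obtain ⟨s, hs, hNs⟩ := hNpair (x ∘ Sum.inl) (dirCoeff j x)
      rw [← dirVec_eq] at hs hNs
      have hne : fderiv ℝ φ (x ∘ Sum.inl) (dirVec j e x) ≠ 0 := h.fderiv_dirVec_ne_zero j x
      have hs0 : s ≠ 0 := by
        rintro rfl
        rw [dirCoeff_self] at hs
        simp at hs
        exact hne (dotProduct_self_eq_zero.1 hs.symm)
      simp only [nextMap, hNs, base_pair, hl, dirCoeff_self, dirCoeff_succAbove]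
      funext b
      rcases b with b | b
      · rfl
      · simp only [Sum.elim_inr]
        field_simp
    · rintro _ ⟨p, hp, w, hw, hw0, rfl⟩ ⟨hpU, hpN⟩
      rw [Set.mem_preimage, base_pair] at hpU
      have hp' := hC p hp hpU
      rw [← hp'] at hw
      obtain ⟨a, rfl⟩ := hD.exists_coeff hw
      obtain ⟨s, hs, hNs⟩ := hNpair (ψ p) a
      rw [hp'] at hNs
      rw [Set.mem_preimage, hNs j] at hpN
      have hs0 : s ≠ 0 := fun h0 => hpN (by simp [h0])
      have ha0 : a j ≠ 0 := fun h0 => hpN (by simp [h0])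
      simp only [hNs, base_pair]
      have := nextMap_of_coeff φ e (ψ p) a j ha0
      rw [hp'] at this
      rw [this]
      congr 2
      funext m
      rw [mul_div_mul_left _ _ hs0]

end Step

/-! ### Tangent spaces and prolonged subsets in a chart -/

section Step
variable {ι α : Type} [Fintype ι]

lemma tangentSpan_mono {Z Z' : Set (ι → ℝ)} (h : Z ⊆ Z') (p : ι → ℝ) :
    tangentSpan Z p ≤ tangentSpan Z' p := by
  refine Submodule.span_mono ?_
  rintro w ⟨γ, h1, h2, h3, h4⟩
  exact ⟨γ, h1, h2, h3.mono fun t ht => h ht, h4⟩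

lemma nextFrame_inl (j : Fin 3) (e : Fin 3 → (α → ℝ) → (α → ℝ)) (x : α ⊕ Fin 2 → ℝ) (i : Fin 3) :
    nextFrame j e i x ∘ Sum.inl = (if i = 0 then (1 : ℝ) else 0) • dirVec j e x := by
  refine Fin.cases ?_ (fun m => ?_) i
  · simp [nextFrame]
  · simp [nextFrame, Fin.succ_ne_zero]

variable [Fintype α]
variable {φ : (α → ℝ) → (ι → ℝ)} {e : Fin 3 → (α → ℝ) → (α → ℝ)}

/-- A smooth curve that stays in the part `C` parametrized by `φ` has a smooth coordinate
expression. -/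
lemma Coords.exists_lift {C : Set (ι → ℝ)} (h : Coords C φ e) {γ : ℝ → (ι → ℝ)}
    (hγ : ContDiff ℝ ∞ γ) {t₀ : ℝ} {x : α → ℝ} (h0 : γ t₀ = φ x)
    (hC : ∀ᶠ t in 𝓝 t₀, γ t ∈ C) :
    ∃ ξ : ℝ → (α → ℝ), ξ t₀ = x ∧ ∀ᶠ t in 𝓝 t₀, ContDiffAt ℝ ∞ ξ t ∧ γ t = φ (ξ t) ∧
      deriv γ t = fderiv ℝ φ (ξ t) (deriv ξ t) := by
  obtain ⟨ψ, U, hU, hψ, hm, hl, hr⟩ := h.inverse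
  refine ⟨ψ ∘ γ, by simp [h0, hl], ?_⟩
  have hUt : ∀ᶠ t in 𝓝 t₀, γ t ∈ U :=
    hγ.continuous.continuousAt.eventually_mem (hU.mem_nhds (h0 ▸ hm x))
  have heq : ∀ᶠ t in 𝓝 t₀, γ t = φ ((ψ ∘ γ) t) := by
    filter_upwards [hC, hUt] with t h1 h2
    exact (hr _ h1 h2).symm
  filter_upwards [heq.eventually_nhds, hUt] with t h1 h2
  have hs : ContDiffAt ℝ ∞ (ψ ∘ γ) t :=
    (hψ.contDiffAt (hU.mem_nhds h2)).comp t hγ.contDiffAt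
  refine ⟨hs, h1.self_of_nhds, ?_⟩
  have h3 : HasDerivAt (ψ ∘ γ) (deriv (ψ ∘ γ) t) t :=
    (hs.differentiableAt (by simp)).hasDerivAt
  have h4 : HasFDerivAt φ (fderiv ℝ φ ((ψ ∘ γ) t)) ((ψ ∘ γ) t) :=
    (h.smooth.contDiffAt.differentiableAt (by simp)).hasFDerivAt
  exact ((h4.comp_hasDerivAt t h3).congr_of_eventuallyEq h1).deriv

/-- Smooth curves in `B` lift to the chart near time `0`, so a linear condition satisfied by all
coordinate velocities passes to the span of the velocities. -/
lemma Coords.tangentSpan_le {C : Set (ι → ℝ)} (h : Coords C φ e) {B : Set (ι → ℝ)} (hB : B ⊆ C)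
    {x : α → ℝ} (W : Submodule ℝ (α → ℝ))
    (hW : ∀ ξ : ℝ → (α → ℝ), DifferentiableAt ℝ ξ 0 → ξ 0 = x → (∀ᶠ t in 𝓝 0, φ (ξ t) ∈ B) →
      deriv ξ 0 ∈ W) :
    tangentSpan B (φ x) ≤ W.map (fderiv ℝ φ x).toLinearMap := by
  refine Submodule.span_le.2 ?_
  rintro w ⟨γ, h1, h2, h3, rfl⟩
  obtain ⟨ξ, hξ, hl⟩ := h.exists_lift h1 h2 (h3.mono fun t ht => hB ht)
  obtain ⟨hs, -, hd⟩ := hl.self_of_nhds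
  refine ⟨deriv ξ 0, hW ξ (hs.differentiableAt (by simp)) hξ ?_, ?_⟩
  · filter_upwards [h3, hl] with t h4 h5
    rw [← h5.2.1]
    exact h4
  · rw [hd, hξ]
    rfl

lemma Coords.mem_tangentSpan {C : Set (ι → ℝ)} (h : Coords C φ e) {B : Set (ι → ℝ)}
    {ξ : ℝ → (α → ℝ)} (hξ : ContDiff ℝ ∞ ξ) (hB : ∀ t, φ (ξ t) ∈ B) :
    fderiv ℝ φ (ξ 0) (deriv ξ 0) ∈ tangentSpan B (φ (ξ 0)) := by
  refine Submodule.subset_span ⟨φ ∘ ξ, h.smooth.comp hξ, rfl, Filter.Eventually.of_forall hB, ?_⟩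
  have h3 : HasDerivAt ξ (deriv ξ 0) 0 :=
    (hξ.contDiffAt.differentiableAt (by simp)).hasDerivAt
  have h4 : HasFDerivAt φ (fderiv ℝ φ (ξ 0)) (ξ 0) :=
    (h.smooth.contDiffAt.differentiableAt (by simp)).hasFDerivAt
  exact (h4.comp_hasDerivAt 0 h3).deriv

/-- In the chart `φ`, the space `B` is the set `Z`, and its distribution is spanned by the members
of the frame `e` with index in `J`. -/
structure SubChart (B : DistSpace ι) (φ : (α → ℝ) → (ι → ℝ)) (e : Fin 3 → (α → ℝ) → (α → ℝ))
    (Z : Set (α → ℝ)) (J : Set (Fin 3)) : Prop where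
  mem_iff : ∀ x, φ x ∈ B.carrier ↔ x ∈ Z
  dist : ∀ x ∈ Z, B.dist (φ x) = Submodule.span ℝ ((fun i => fderiv ℝ φ x (e i x)) '' J)
  curve : ∀ x ∈ Z, ∀ a : Fin 3 → ℝ, (∀ i, i ∉ J → a i = 0) →
    ∃ γ : ℝ → (α → ℝ), ContDiff ℝ ∞ γ ∧ γ 0 = x ∧ deriv γ 0 = ∑ i, a i • e i x ∧ ∀ t, γ t ∈ Z

/-- The coordinate description of the prolongation of a space described by `Z` and `J`. -/
def nextSet (j : Fin 3) (Z : Set (α → ℝ)) (J : Set (Fin 3)) : Set (α ⊕ Fin 2 → ℝ) :=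
  {x | x ∘ Sum.inl ∈ Z ∧ ∀ i, i ∉ J → dirCoeff j x i = 0}

/-- Position `0`, the lift of the chosen direction, always belongs. A fiber direction `m.succ`
belongs when the coefficient at `j.succAbove m` is free to vary. -/
def nextIdx (j : Fin 3) (J : Set (Fin 3)) : Set (Fin 3) :=
  {i | ∀ m : Fin 2, i = m.succ → j.succAbove m ∈ J}

lemma base_fderiv_nextMap {C : Set (ι → ℝ)} (h : Coords C φ e) (j : Fin 3)
    (x y : α ⊕ Fin 2 → ℝ) :
    base (fderiv ℝ (nextMap j e φ) x y) = fderiv ℝ φ (x ∘ Sum.inl) (y ∘ Sum.inl) := by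
  let b : (ι ⊕ ι × ι → ℝ) →L[ℝ] (ι → ℝ) := LinearMap.toContinuousLinearMap base
  have h1 : HasFDerivAt (nextMap j e φ) (fderiv ℝ (nextMap j e φ) x) x :=
    ((h.smooth_nextMap j).contDiffAt.differentiableAt (by simp)).hasFDerivAt
  have h2 : HasFDerivAt (fun x => b (nextMap j e φ x)) (b.comp (fderiv ℝ (nextMap j e φ) x)) x :=
    b.hasFDerivAt.comp x h1
  have h3 : HasFDerivAt φ (fderiv ℝ φ (lower x)) (lower x) :=
    (h.smooth.contDiffAt.differentiableAt (by simp)).hasFDerivAt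
  have h4 : HasFDerivAt (fun x => φ (lower x)) ((fderiv ℝ φ (lower x)).comp lower) x :=
    h3.comp x lower.hasFDerivAt
  have h5 := h2.unique h4
  exact congrArg (fun L => L y) h5

lemma line_nextMap {C : Set (ι → ℝ)} (h : Coords C φ e) (j : Fin 3) (x : α ⊕ Fin 2 → ℝ) :
    line (nextMap j e φ x) =
      Submodule.span ℝ {fderiv ℝ φ (x ∘ Sum.inl) (dirVec j e x)} :=
  line_pair _ (h.fderiv_dirVec_ne_zero j x)

lemma SubChart.mem_nextSet_iff {D B : DistSpace ι} (h : Coords D.carrier φ e)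
    {Z : Set (α → ℝ)} {J : Set (Fin 3)} (hB : SubChart B φ e Z J) (j : Fin 3)
    (x : α ⊕ Fin 2 → ℝ) : nextMap j e φ x ∈ B.prolong.carrier ↔ x ∈ nextSet j Z J := by
  have h0 := h.fderiv_dirVec_ne_zero j x
  have key : x ∘ Sum.inl ∈ Z → (fderiv ℝ φ (x ∘ Sum.inl) (dirVec j e x) ∈
      B.dist (φ (x ∘ Sum.inl)) ↔ ∀ i, i ∉ J → dirCoeff j x i = 0) := by
    intro hx
    rw [hB.dist _ hx, fderiv_dirVec_eq]
    exact sum_smul_mem_span_image_iff (h.linearIndependent _) _ _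
  constructor
  · rintro ⟨p, hp, w, hw, hw0, hq⟩
    obtain ⟨rfl, s, hs, rfl⟩ := (pair_eq_pair_iff h0 hw0).1 hq
    have hx := (hB.mem_iff _).1 hp
    refine ⟨hx, (key hx).1 ?_⟩
    exact ((B.dist _).smul_mem_iff hs).1 hw
  · rintro ⟨hx, hJ⟩
    exact ⟨_, (hB.mem_iff _).2 hx, _, (key hx).2 hJ, h0, rfl⟩

/-- A supply of curves inside the set is what shows that the frame vectors really are tangent to it.
To lift, follow the given direction with speed `a 0` below and move the fiber coordinates affinely;
coordinates required to vanish start at zero with zero speed. -/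
lemma nextSet_curve {Z : Set (α → ℝ)} {J : Set (Fin 3)}
    (hc : ∀ x ∈ Z, ∀ a : Fin 3 → ℝ, (∀ i, i ∉ J → a i = 0) →
      ∃ γ : ℝ → (α → ℝ), ContDiff ℝ ∞ γ ∧ γ 0 = x ∧ deriv γ 0 = ∑ i, a i • e i x ∧ ∀ t, γ t ∈ Z)
    (j : Fin 3) (x : α ⊕ Fin 2 → ℝ) (hx : x ∈ nextSet j Z J) (a : Fin 3 → ℝ)
    (ha : ∀ i, i ∉ nextIdx j J → a i = 0) :
    ∃ γ : ℝ → (α ⊕ Fin 2 → ℝ), ContDiff ℝ ∞ γ ∧ γ 0 = x ∧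
      deriv γ 0 = ∑ i, a i • nextFrame j e i x ∧ ∀ t, γ t ∈ nextSet j Z J := by
  obtain ⟨γ, h1, h2, h3, h4⟩ := hc _ hx.1 (a 0 • dirCoeff j x) fun i hi => by
    rw [Pi.smul_apply, hx.2 i hi, smul_zero]
  have hlin : ContDiff ℝ ∞ fun t : ℝ => (fun m : Fin 2 => x (Sum.inr m) + t * a m.succ) :=
    contDiff_pi.2 fun m => contDiff_const.add (contDiff_id.mul contDiff_const)
  refine ⟨fun t => Sum.elim (γ t) fun m => x (Sum.inr m) + t * a m.succ,
    contDiff_sumElim h1 hlin, ?_, ?_, ?_⟩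
  · funext b
    rcases b with b | b <;> simp [h2]
  · rw [sum_smul_nextFrame]
    refine HasDerivAt.deriv (hasDerivAt_pi.2 ?_)
    have h5 : HasDerivAt γ (a 0 • dirVec j e x) 0 := by
      have := (h1.contDiffAt.differentiableAt (x := 0) (by simp)).hasDerivAt
      rw [h3] at this
      have h6 : a 0 • dirVec j e x = ∑ i, (a 0 • dirCoeff j x) i • e i (x ∘ Sum.inl) := by
        rw [dirVec_eq, Finset.smul_sum]
        exact Finset.sum_congr rfl fun i _ => by rw [Pi.smul_apply, smul_eq_mul, mul_smul]
      rwa [h6]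
    rintro (b | m)
    · exact hasDerivAt_pi.1 h5 b
    · simpa using ((hasDerivAt_id (0 : ℝ)).mul_const (a m.succ)).const_add (x (Sum.inr m))
  · intro t
    refine ⟨h4 t, fun i hi => ?_⟩
    have h6 := hx.2 i hi
    rcases Fin.eq_self_or_eq_succAbove j i with rfl | ⟨m, rfl⟩
    · simp at h6
    · rw [dirCoeff_succAbove] at h6 ⊢
      have h7 : a m.succ = 0 := ha _ fun h => hi (h m rfl)
      simp [h6, h7]

/-- A tangent vector satisfies two constraints: its fiber components outside `J` vanish, and its
projection is a multiple of `dirVec`. Together they leave only the frame vectors indexed by `nextIdx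
j J`. Conversely, `nextSet_curve` realizes each of these as a velocity. -/
lemma SubChart.next {D B : DistSpace ι} (h : Coords D.carrier φ e) (hD : Spans D φ e)
    (hBD : B.prolong.carrier ⊆ D.prolong.carrier)
    {Z : Set (α → ℝ)} {J : Set (Fin 3)} (hB : SubChart B φ e Z J) (j : Fin 3) :
    SubChart B.prolong (nextMap j e φ) (nextFrame j e) (nextSet j Z J) (nextIdx j J) where
  mem_iff := hB.mem_nextSet_iff h j
  curve := nextSet_curve hB.curve j
  dist x hx := by
    have hN := h.next hD j
    change tangentSpan B.prolong.carrier _ ⊓ (line _).comap base = _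
    rw [line_nextMap h]
    apply le_antisymm
    · rintro w ⟨hw, hwl⟩
      -- Only the fiber equations are differentiated; the lower part of the velocity is controlled
      -- by the line condition.
      let W : Submodule ℝ (α ⊕ Fin 2 → ℝ) :=
        ⨅ (m : Fin 2) (_ : j.succAbove m ∉ J), LinearMap.ker (LinearMap.proj (Sum.inr m))
      have hW : ∀ y, y ∈ W ↔ ∀ m : Fin 2, j.succAbove m ∉ J → y (Sum.inr m) = 0 := by
        intro y
        simp [W, Submodule.mem_iInf]
      obtain ⟨y, hy, rfl⟩ := hN.tangentSpan_le hBD W (x := x) (fun ξ hξ h0 hm => by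
        rw [hW]
        intro m hmJ
        have h1 : (fun t => ξ t (Sum.inr m)) =ᶠ[𝓝 0] fun _ => 0 := by
          filter_upwards [hm] with t ht
          have := ((hB.mem_nextSet_iff h j _).1 ht).2 _ hmJ
          rwa [dirCoeff_succAbove] at this
        have h2 := hasDerivAt_pi.1 hξ.hasDerivAt (Sum.inr m)
        exact h2.unique ((hasDerivAt_const (0 : ℝ) (0 : ℝ)).congr_of_eventuallyEq h1)) hw
      replace hy := (hW y).1 hy
      have hwl' : base (fderiv ℝ (nextMap j e φ) x y) ∈
        Submodule.span ℝ {fderiv ℝ φ (x ∘ Sum.inl) (dirVec j e x)} := hwl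
      rw [base_fderiv_nextMap h, Submodule.mem_span_singleton] at hwl'
      obtain ⟨s, hs⟩ := hwl'
      rw [← map_smul] at hs
      have hs' := h.fderiv_injective _ hs
      let a : Fin 3 → ℝ := Fin.cons s fun m => y (Sum.inr m)
      have hya : y = ∑ i, a i • nextFrame j e i x := by
        rw [sum_smul_nextFrame]
        funext b
        rcases b with b | b
        · exact (congrFun hs' b).symm
        · simp [a]
      change fderiv ℝ (nextMap j e φ) x y ∈ _
      rw [hya, map_sum]
      simp only [map_smul]
      refine (sum_smul_mem_span_image_iff (hN.linearIndependent x) _ _).2 fun i hi => ?_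
      simp only [nextIdx, Set.mem_ofPred_eq, not_forall] at hi
      obtain ⟨m, rfl, hm⟩ := hi
      exact hy m hm
    · refine Submodule.span_le.2 ?_
      rintro _ ⟨i, hi, rfl⟩
      refine ⟨?_, ?_⟩
      · obtain ⟨γ, h1, h2, h3, h4⟩ := nextSet_curve hB.curve j x hx (Pi.single i 1)
          fun l hl => Pi.single_eq_of_ne (fun hli : l = i => hl (hli ▸ hi)) _
        have := hN.mem_tangentSpan h1 fun t => (hB.mem_nextSet_iff h j _).2 (h4 t)
        rw [h2, h3] at this
        simpa [Pi.single_apply] using this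
      · refine Submodule.mem_comap.2 ?_
        rw [base_fderiv_nextMap h, nextFrame_inl, map_smul]
        exact Submodule.smul_mem _ _ (Submodule.mem_span_singleton_self _)

end Step

/-! ### Kumpera-Rubin charts of the tower -/

lemma krPoint_succ (c : ℕ → Fin 3) (k : ℕ) :
    krPoint c (k + 1) = nextMap (c k) (krFrame c k) (krPoint c k) := rfl

lemma krFrame_succ (c : ℕ → Fin 3) (k : ℕ) :
    krFrame c (k + 1) = nextFrame (c k) (krFrame c k) := by
  funext i x
  refine Fin.cases rfl (fun m => ?_) i
  change (Pi.single (Sum.inr m) 1 : KRIdx k ⊕ Fin 2 → ℝ) =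
    Sum.elim (0 : KRIdx k → ℝ) (Pi.single m 1 : Fin 2 → ℝ)
  funext b
  rcases b with b | b
  · exact Pi.single_eq_of_ne (by simp) _
  · by_cases hb : b = m
    · subst hb
      simp
    · rw [Pi.single_eq_of_ne (by simpa using hb), Sum.elim_inr, Pi.single_eq_of_ne hb]

/-- Kumpera-Rubin charts are smooth coordinates on the levels of the tower, and their frames span
the distributions. -/
lemma tower_chart (c : ℕ → Fin 3) (k : ℕ) :
    Coords (tower k).carrier (krPoint c k) (krFrame c k) ∧
      SubChart (tower k) (krPoint c k) (krFrame c k) Set.univ Set.univ := by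
  induction k with
  | zero =>
    have hid : krPoint c 0 = id := rfl
    have hfr : ∀ i x, krFrame c 0 i x = (Pi.single i 1 : Fin 3 → ℝ) := fun _ _ => rfl
    constructor
    · refine ⟨contDiff_id, fun i => contDiff_const, ⟨fun i _ => ContinuousLinearMap.proj i,
        fun i => contDiff_const, fun x i l => ?_⟩, ⟨id, Set.univ, isOpen_univ, contDiffOn_id,
        fun _ => trivial, fun _ => rfl, fun _ _ _ => rfl⟩, fun _ => trivial⟩
      simp only [hfr, ContinuousLinearMap.proj_apply, Pi.single_apply]
    · have hsum : ∀ a : Fin 3 → ℝ, ∑ i, a i • (Pi.single i 1 : Fin 3 → ℝ) = a := fun a => by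
        funext b
        simp [Finset.sum_apply, Pi.single_apply]
      refine ⟨fun x => Iff.rfl, fun x _ => ?_, fun x _ a _ => ?_⟩
      · symm
        refine Submodule.eq_top_iff'.2 fun w => ?_
        rw [hid, fderiv_id, ← hsum w]
        exact Submodule.sum_mem _ fun i _ =>
          Submodule.smul_mem _ _ (Submodule.subset_span ⟨i, trivial, rfl⟩)
      · refine ⟨fun t => x + t • a, contDiff_const.add (contDiff_id.smul contDiff_const), by simp,
          ?_, fun _ => trivial⟩
        have := ((hasDerivAt_id (0 : ℝ)).smul_const a).const_add x
        simp only [one_smul] at this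
        refine (this.deriv).trans ?_
        exact (hsum a).symm
  | succ k ih =>
    obtain ⟨h, hs⟩ := ih
    have hD : Spans (tower k) (krPoint c k) (krFrame c k) := fun x => hs.dist x trivial
    rw [krPoint_succ, krFrame_succ]
    refine ⟨h.next hD (c k), ?_⟩
    have := hs.next h hD subset_rfl (c k)
    have h1 : nextSet (c k) (Set.univ : Set (KRSpace k)) Set.univ = Set.univ :=
      Set.eq_univ_of_forall fun x => ⟨trivial, fun i hi => absurd (Set.mem_univ i) hi⟩
    have h2 : nextIdx (c k) Set.univ = Set.univ := Set.eq_univ_of_forall fun x m _ => trivial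
    rw [h1, h2] at this
    exact this

lemma krCoords (c : ℕ → Fin 3) (k : ℕ) :
    Coords (tower k).carrier (krPoint c k) (krFrame c k) := (tower_chart c k).1

lemma krSpans (c : ℕ → Fin 3) (k : ℕ) : Spans (tower k) (krPoint c k) (krFrame c k) :=
  fun x => (tower_chart c k).2.dist x trivial

lemma krPlane_eq (c : ℕ → Fin 3) (k : ℕ) (x : KRSpace k) (i : Fin 3) :
    krPlane c k x i =
      Submodule.span ℝ ((fun n => fderiv ℝ (krPoint c k) x (krFrame c k n x)) '' {i}ᶜ) := by
  refine congrArg (Submodule.span ℝ) (Set.ext fun w => ⟨?_, ?_⟩)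
  · rintro ⟨n, hn, hw⟩
    exact ⟨n, hn, hw.symm⟩
  · rintro ⟨n, hn, hw⟩
    exact ⟨n, hn, hw.symm⟩

lemma sum_smul_mem_krPlane_iff (c : ℕ → Fin 3) (k : ℕ) (x : KRSpace k) (i : Fin 3)
    (a : Fin 3 → ℝ) :
    ∑ n, a n • fderiv ℝ (krPoint c k) x (krFrame c k n x) ∈ krPlane c k x i ↔ a i = 0 := by
  rw [krPlane_eq, sum_smul_mem_span_image_iff ((krCoords c k).linearIndependent x)]
  simp

lemma krPlane_injective (c : ℕ → Fin 3) (k : ℕ) (x : KRSpace k) :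
    Function.Injective (krPlane c k x) := by
  intro i l h
  by_contra hil
  have h1 := (sum_smul_mem_krPlane_iff c k x i (Pi.single l 1)).2 (Pi.single_eq_of_ne hil 1)
  rw [h] at h1
  have h2 := (sum_smul_mem_krPlane_iff c k x l (Pi.single l 1)).1 h1
  simp at h2

/-! ### Critical planes in coordinates -/

/-- The positions `i` such that the `i`-th covector of the coframing vanishes on a critical plane. -/
def critPos (c : ℕ → Fin 3) : (k : ℕ) → KRSpace k → Set (Fin 3)
  | 0, _ => ∅
  | k + 1, x => {i | ∀ m : Fin 2, i = m.succ →
      (c k).succAbove m ∈ critPos c k (x ∘ Sum.inl) ∧ x (Sum.inr m) = 0}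

lemma zero_mem_critPos (c : ℕ → Fin 3) (k : ℕ) (x : KRSpace (k + 1)) : 0 ∈ critPos c (k + 1) x :=
  fun m h => absurd h.symm (Fin.succ_ne_zero m)

/-- The two conditions say that the plane below is critical and that the new line lies in it, its
coefficient there being `x (Sum.inr m)`. -/
lemma succ_mem_critPos (c : ℕ → Fin 3) (k : ℕ) (x : KRSpace (k + 1)) (m : Fin 2) :
    m.succ ∈ critPos c (k + 1) x ↔
      (c k).succAbove m ∈ critPos c k (x ∘ Sum.inl) ∧ x (Sum.inr m) = 0 := by
  constructor
  · exact fun h => h m rfl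
  · intro h m' hm
    rwa [← Fin.succ_injective _ hm]

/-- By injectivity of the lower parametrization, a fiber is a fixed value of the lower coordinates:
its curves have no lower velocity, and affine motion of the last two coordinates stays inside it. -/
lemma fiber_subChart (c : ℕ → Fin 3) (k : ℕ) (p : Amb k) :
    SubChart { carrier := fiber p, dist := tangentSpan (fiber p) } (krPoint c (k + 1))
      (krFrame c (k + 1)) {x | krPoint c k (x ∘ Sum.inl) = p} {0}ᶜ := by
  have h := krCoords c k
  have hN := krCoords c (k + 1)
  have hmem : ∀ x, krPoint c (k + 1) x ∈ fiber p ↔ krPoint c k (x ∘ Sum.inl) = p := fun x =>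
    ⟨fun hx => hx.2, fun hx => ⟨hN.mem x, hx⟩⟩
  have hcurve : ∀ x ∈ {x : KRSpace (k + 1) | krPoint c k (x ∘ Sum.inl) = p}, ∀ a : Fin 3 → ℝ,
      (∀ i, i ∉ ({0}ᶜ : Set (Fin 3)) → a i = 0) →
      ∃ γ : ℝ → KRSpace (k + 1), ContDiff ℝ ∞ γ ∧ γ 0 = x ∧
        deriv γ 0 = ∑ i, a i • krFrame c (k + 1) i x ∧
        ∀ t, γ t ∈ {x : KRSpace (k + 1) | krPoint c k (x ∘ Sum.inl) = p} := by
    intro x hx a ha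
    have ha0 : a 0 = 0 := ha 0 (by simp)
    let y : KRSpace (k + 1) := Sum.elim 0 fun m => a m.succ
    refine ⟨fun t => x + t • y, contDiff_const.add (contDiff_id.smul contDiff_const), by simp,
      ?_, fun t => ?_⟩
    · have := ((hasDerivAt_id (0 : ℝ)).smul_const y).const_add x
      simp only [one_smul] at this
      refine this.deriv.trans ?_
      rw [krFrame_succ, sum_smul_nextFrame, ha0, zero_smul]
    · have : (x + t • y) ∘ Sum.inl = x ∘ Sum.inl := by
        funext b
        simp [y]
      change krPoint c k ((x + t • y) ∘ Sum.inl) = p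
      rw [this]
      exact hx
  refine ⟨hmem, fun x hx => ?_, hcurve⟩
  apply le_antisymm
  · change tangentSpan (fiber p) _ ≤ _
    let W : Submodule ℝ (KRSpace (k + 1)) := LinearMap.ker (lower (α := KRIdx k)).toLinearMap
    refine (hN.tangentSpan_le (fun q hq => hq.1) W fun ξ hξ h0 hm => ?_).trans ?_
    · have h1 : (fun t => lower (ξ t)) =ᶠ[𝓝 0] fun _ => x ∘ Sum.inl := by
        filter_upwards [hm] with t ht
        exact h.injective (((hmem _).1 ht).trans hx.symm)
      have h2 : HasDerivAt (fun t => lower (ξ t)) (lower (deriv ξ 0)) 0 :=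
        (lower (α := KRIdx k)).hasFDerivAt.comp_hasDerivAt 0 hξ.hasDerivAt
      exact h2.unique ((hasDerivAt_const (0 : ℝ) (x ∘ Sum.inl)).congr_of_eventuallyEq h1)
    · rintro _ ⟨y, hy, rfl⟩
      have hy' : y ∘ Sum.inl = 0 := hy
      let a : Fin 3 → ℝ := Fin.cons 0 fun m => y (Sum.inr m)
      have hya : y = ∑ i, a i • krFrame c (k + 1) i x := by
        rw [krFrame_succ, sum_smul_nextFrame]
        funext b
        rcases b with b | b
        · simpa [a] using congrFun hy' b
        · simp [a]
      change fderiv ℝ (krPoint c (k + 1)) x y ∈ _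
      rw [hya, map_sum]
      simp only [map_smul]
      refine (sum_smul_mem_span_image_iff (hN.linearIndependent x) _ _).2 fun i hi => ?_
      have : i = 0 := by simpa using hi
      rw [this]
      rfl
  · refine Submodule.span_le.2 ?_
    rintro _ ⟨i, hi, rfl⟩
    obtain ⟨γ, h1, h2, h3, h4⟩ := hcurve x hx (Pi.single i 1)
      fun l hl => Pi.single_eq_of_ne (fun hli : l = i => hl (hli ▸ hi)) _
    have := hN.mem_tangentSpan h1 fun t => (hmem _).2 (h4 t)
    rw [h2, h3] at this
    simpa [Pi.single_apply] using this

lemma prolong_mono {ι : Type} [Fintype ι] {B D : DistSpace ι} (hc : B.carrier ⊆ D.carrier)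
    (hd : ∀ p ∈ B.carrier, B.dist p ≤ D.dist p) :
    B.prolong.carrier ⊆ D.prolong.carrier ∧
      ∀ q ∈ B.prolong.carrier, B.prolong.dist q ≤ D.prolong.dist q := by
  have h : B.prolong.carrier ⊆ D.prolong.carrier := by
    rintro q ⟨p, hp, w, hw, hw0, rfl⟩
    exact ⟨p, hc hp, w, hd p hp hw, hw0, rfl⟩
  exact ⟨h, fun q _ => inf_le_inf_right _ (tangentSpan_mono h q)⟩

/-- Vertical vectors project to zero, which lies in every line. -/
lemma tangentSpan_fiber_le {k : ℕ} (p : Amb k) (q : Amb (k + 1)) :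
    tangentSpan (fiber p) q ≤ (tower (k + 1)).dist q := by
  refine le_inf (tangentSpan_mono (fun q hq => hq.1) q) (Submodule.span_le.2 ?_)
  rintro w ⟨γ, h1, h2, h3, rfl⟩
  let b : Amb (k + 1) →L[ℝ] Amb k := LinearMap.toContinuousLinearMap base
  have h4 : HasDerivAt (fun t => b (γ t)) (b (deriv γ 0)) 0 :=
    b.hasFDerivAt.comp_hasDerivAt 0 (h1.contDiffAt.differentiableAt (by simp)).hasDerivAt
  have h5 : (fun t => b (γ t)) =ᶠ[𝓝 0] fun _ => p := h3.mono fun t ht => ht.2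
  have h6 : base (deriv γ 0) = 0 :=
    h4.unique ((hasDerivAt_const (0 : ℝ) p).congr_of_eventuallyEq h5)
  change base (deriv γ 0) ∈ line q
  rw [h6]
  exact Submodule.zero_mem _

lemma babyMonster_le {k : ℕ} {B : DistSpace (Idx k)} (hB : B ∈ babyMonsters k) :
    B.carrier ⊆ (tower k).carrier ∧ ∀ q ∈ B.carrier, B.dist q ≤ (tower k).dist q := by
  induction k with
  | zero => exact absurd hB id
  | succ k ih =>
    rcases hB with ⟨p, hp, rfl⟩ | ⟨B', hB', rfl⟩
    · exact ⟨fun q hq => hq.1, fun q _ => tangentSpan_fiber_le p q⟩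
    · exact prolong_mono (ih hB').1 (ih hB').2

lemma nextIdx_compl (j : Fin 3) (m : Fin 2) : nextIdx j {j.succAbove m}ᶜ = {m.succ}ᶜ := by
  ext i
  simp only [nextIdx, Set.mem_compl_iff, Set.mem_singleton_iff, Set.mem_ofPred_eq]
  constructor
  · intro h hi
    exact h m hi rfl
  · rintro h m' rfl hm
    exact h (by rw [Fin.succAbove_right_injective hm])

/-- By induction along the prolongations, a Baby Monster meets a chart in a set whose planes all sit
at one position `i`. -/
lemma babyMonster_subChart (c : ℕ → Fin 3) {k : ℕ} {B : DistSpace (Idx k)}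
    (hB : B ∈ babyMonsters k) :
    ∃ (i : Fin 3) (Z : Set (KRSpace k)), SubChart B (krPoint c k) (krFrame c k) Z {i}ᶜ ∧
      ∀ x ∈ Z, i ∈ critPos c k x := by
  induction k with
  | zero => exact absurd hB id
  | succ k ih =>
    rcases hB with ⟨p, hp, rfl⟩ | ⟨B', hB', rfl⟩
    · exact ⟨0, _, fiber_subChart c k p, fun x _ => zero_mem_critPos c k x⟩
    · obtain ⟨i, Z, h, hZ⟩ := ih hB'
      have hle := babyMonster_le hB'
      have hN := h.next (krCoords c k) (krSpans c k) (prolong_mono hle.1 hle.2).1 (c k)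
      rw [← krPoint_succ, ← krFrame_succ] at hN
      rcases Fin.eq_self_or_eq_succAbove (c k) i with rfl | ⟨m, rfl⟩
      -- Directions in the plane at position `c k` have zero divisor coefficient, so this chart
      -- misses the prolongation altogether and the position `0` given next is arbitrary.
      · have hempty : ∀ x, x ∉ nextSet (c k) Z {c k}ᶜ := by
          intro x hx
          have := hx.2 (c k) (by simp)
          simp at this
        exact ⟨0, _, ⟨hN.mem_iff, fun x hx => absurd hx (hempty x),
          fun x hx => absurd hx (hempty x)⟩, fun x hx => absurd hx (hempty x)⟩
      · rw [nextIdx_compl] at hN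
        refine ⟨_, _, hN, fun x hx => (succ_mem_critPos _ _ _ _).2 ⟨hZ _ hx.1, ?_⟩⟩
        have := hx.2 ((c k).succAbove m) (by simp)
        rwa [dirCoeff_succAbove] at this

/-- The recursion defining `critPos` rebuilds the Baby Monster: position `0` starts a fiber, and a
successor position prolongs one from the level below. -/
lemma exists_babyMonster (c : ℕ → Fin 3) {k : ℕ} {x : KRSpace k} {i : Fin 3}
    (hi : i ∈ critPos c k x) :
    ∃ B ∈ babyMonsters k, ∃ Z : Set (KRSpace k),
      SubChart B (krPoint c k) (krFrame c k) Z {i}ᶜ ∧ x ∈ Z := by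
  induction k generalizing i with
  | zero => exact absurd hi id
  | succ k ih =>
    revert hi
    refine Fin.cases (fun _ => ?_) (fun m hi => ?_) i
    · exact ⟨_, Or.inl ⟨krPoint c k (x ∘ Sum.inl), (krCoords c k).mem _, rfl⟩, _,
        fiber_subChart c k _, rfl⟩
    · rw [succ_mem_critPos] at hi
      obtain ⟨B', hB', Z, h, hZ⟩ := ih hi.1
      have hle := babyMonster_le hB'
      have hN := h.next (krCoords c k) (krSpans c k) (prolong_mono hle.1 hle.2).1 (c k)
      rw [← krPoint_succ, ← krFrame_succ, nextIdx_compl] at hN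
      refine ⟨_, Or.inr ⟨B', hB', rfl⟩, _, hN, hZ, fun l hl => ?_⟩
      have : l = (c k).succAbove m := by simpa using hl
      rw [this, dirCoeff_succAbove]
      exact hi.2

lemma isCriticalPlane_iff (c : ℕ → Fin 3) {k : ℕ} (x : KRSpace k) (H : Submodule ℝ (Amb k)) :
    IsCriticalPlane (krPoint c k x) H ↔ ∃ i ∈ critPos c k x, H = krPlane c k x i := by
  constructor
  · rintro ⟨B, hB, hx, rfl⟩
    obtain ⟨i, Z, h, hZ⟩ := babyMonster_subChart c hB
    have hxZ := (h.mem_iff x).1 hx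
    exact ⟨i, hZ x hxZ, by rw [h.dist x hxZ, krPlane_eq]⟩
  · rintro ⟨i, hi, rfl⟩
    obtain ⟨B, hB, Z, h, hZ⟩ := exists_babyMonster c hi
    exact ⟨B, hB, (h.mem_iff x).2 hZ, by rw [h.dist x hZ, krPlane_eq]⟩

lemma isVerticalPlane_iff (c : ℕ → Fin 3) {k : ℕ} (x : KRSpace k) (H : Submodule ℝ (Amb k)) :
    IsVerticalPlane (krPoint c k x) H ↔ 0 ∈ critPos c k x ∧ H = krPlane c k x 0 := by
  cases k with
  | zero => exact ⟨fun h => absurd h id, fun h => absurd h.1 id⟩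
  | succ k =>
    have h : tangentSpan (fiber (proj (krPoint c (k + 1) x))) (krPoint c (k + 1) x) =
        krPlane c (k + 1) x 0 := by
      rw [krPlane_eq]
      exact (fiber_subChart c k (proj (krPoint c (k + 1) x))).dist x rfl
    change H = tangentSpan _ _ ↔ _
    rw [h]
    exact ⟨fun h => ⟨zero_mem_critPos c k x, h⟩, fun h => h.2⟩

/-! ### Critical directions in coordinates -/

/-- The coordinates of the projection to level `0`. -/
def krZero : {k : ℕ} → KRSpace k → KRSpace 0
  | 0, x => x
  | _ + 1, x => krZero (x ∘ Sum.inl)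

lemma projZero_krPoint (c : ℕ → Fin 3) {k : ℕ} (x : KRSpace k) :
    projZero (krPoint c k x) = krZero x := by
  induction k with
  | zero => rfl
  | succ k ih => exact ih (x ∘ Sum.inl)

lemma exists_primitive {f : ℝ → ℝ} (hf : ContDiff ℝ ∞ f) (y : ℝ) :
    ∃ F : ℝ → ℝ, ContDiff ℝ ∞ F ∧ F 0 = y ∧ ∀ t, HasDerivAt F (f t) t := by
  have h : ∀ t, HasDerivAt (fun t => y + ∫ s in (0 : ℝ)..t, f s) (f t) t := fun t =>
    (intervalIntegral.integral_hasDerivAt_right (hf.continuous.intervalIntegrable _ _)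
      (hf.continuous.stronglyMeasurableAtFilter _ _) hf.continuous.continuousAt).const_add y
  refine ⟨_, contDiff_infty_iff_deriv.2 ⟨fun t => (h t).differentiableAt, ?_⟩, by simp, h⟩
  rw [funext fun t => (h t).deriv]
  exact hf

lemma contDiff_dirCoeff (j : Fin 3) {α : Type} {ξ : ℝ → (α ⊕ Fin 2 → ℝ)}
    (hξ : ∀ m, ContDiff ℝ ∞ fun t => ξ t (Sum.inr m)) (i : Fin 3) :
    ContDiff ℝ ∞ fun t => dirCoeff j (ξ t) i := by
  rcases Fin.eq_self_or_eq_succAbove j i with rfl | ⟨m, rfl⟩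
  · simpa using contDiff_const
  · simpa using hξ m

/-- The system is triangular: the fiber coordinates have derivatives `a m.succ`, and the lower curve
follows the lower frame with coefficients `a 0 * dirCoeff`. This drives every induction on integral
curves. -/
lemma hasDerivAt_nextFrame_iff (c : ℕ → Fin 3) (k : ℕ) {ξ : ℝ → KRSpace (k + 1)}
    {a : Fin 3 → ℝ} {t : ℝ} :
    HasDerivAt ξ (∑ i, a i • krFrame c (k + 1) i (ξ t)) t ↔
      HasDerivAt (fun t => ξ t ∘ Sum.inl)
        (∑ i, (a 0 * dirCoeff (c k) (ξ t) i) • krFrame c k i (ξ t ∘ Sum.inl)) t ∧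
      ∀ m : Fin 2, HasDerivAt (fun t => ξ t (Sum.inr m)) (a m.succ) t := by
  have h1 : a 0 • dirVec (c k) (krFrame c k) (ξ t) =
      ∑ i, (a 0 * dirCoeff (c k) (ξ t) i) • krFrame c k i (ξ t ∘ Sum.inl) := by
    rw [dirVec_eq, Finset.smul_sum]
    exact Finset.sum_congr rfl fun i _ => by rw [mul_smul]
  rw [krFrame_succ, sum_smul_nextFrame, ← h1]
  constructor
  · intro h
    exact ⟨hasDerivAt_pi.2 fun b => hasDerivAt_pi.1 h (Sum.inl b),
      fun m => hasDerivAt_pi.1 h (Sum.inr m)⟩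
  · rintro ⟨h2, h3⟩
    refine hasDerivAt_pi.2 ?_
    rintro (b | m)
    · exact hasDerivAt_pi.1 h2 b
    · exact h3 m

/-- Integral curves of combinations of the frame with prescribed smooth coefficients. -/
lemma exists_integralCurve (c : ℕ → Fin 3) (k : ℕ) (x : KRSpace k) (a : Fin 3 → ℝ → ℝ)
    (ha : ∀ i, ContDiff ℝ ∞ (a i)) :
    ∃ ξ : ℝ → KRSpace k, ContDiff ℝ ∞ ξ ∧ ξ 0 = x ∧
      ∀ t, HasDerivAt ξ (∑ i, a i t • krFrame c k i (ξ t)) t := by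
  induction k generalizing a with
  | zero =>
    choose F h1 h2 h3 using fun i => exists_primitive (ha i) (x i)
    refine ⟨fun t i => F i t, contDiff_pi.2 h1, funext h2, fun t => hasDerivAt_pi.2 fun b => ?_⟩
    have : (∑ i, a i t • krFrame c 0 i fun i => F i t) b = a b t := by
      have : ∀ i x, krFrame c 0 i x = (Pi.single i 1 : Fin 3 → ℝ) := fun _ _ => rfl
      simp [Finset.sum_apply, this, Pi.single_apply]
    rw [this]
    exact h3 b t
  | succ k ih =>
    choose F h1 h2 h3 using fun m : Fin 2 => exists_primitive (ha m.succ) (x (Sum.inr m))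
    -- `dirCoeff` depends only on the fiber coordinates, so an empty lower part lets the
    -- coefficients be written before the lower curve exists.
    let z : ℝ → (Empty ⊕ Fin 2 → ℝ) := fun t => Sum.elim (fun b => b.elim) fun m => F m t
    obtain ⟨ξ, h4, h5, h6⟩ := ih (x ∘ Sum.inl) (fun i t => a 0 t * dirCoeff (c k) (z t) i)
      fun i => (ha 0).mul (contDiff_dirCoeff (c k) h1 i)
    refine ⟨fun t => Sum.elim (ξ t) fun m => F m t, contDiff_sumElim h4 (contDiff_pi.2 h1), ?_,
      fun t => (hasDerivAt_nextFrame_iff c k).2 ⟨h6 t, fun m => h3 m t⟩⟩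
    funext b
    rcases b with b | b
    · exact congrFun h5 b
    · exact h2 b

/-- Integral curves tangent to a critical plane project to constant curves. -/
lemma krZero_eq_of_mem_critPos (c : ℕ → Fin 3) (k : ℕ) {ξ : ℝ → KRSpace k} {a : Fin 3 → ℝ → ℝ}
    (h : ∀ t, HasDerivAt ξ (∑ i, a i t • krFrame c k i (ξ t)) t) {j : Fin 3}
    (hj : j ∈ critPos c k (ξ 0)) (ha : ∀ t, a j t = 0) (t : ℝ) : krZero (ξ t) = krZero (ξ 0) := by
  induction k generalizing a j with
  | zero => exact absurd hj id
  | succ k ih =>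
    have h1 := fun t => (hasDerivAt_nextFrame_iff c k).1 (h t)
    revert hj ha
    refine Fin.cases (fun _ ha => ?_) (fun m hj ha => ?_) j
    -- Without a `df` component the curve is vertical.
    · have h2 : ∀ t, HasDerivAt (fun t => ξ t ∘ Sum.inl) 0 t := fun t => by
        simpa [ha] using (h1 t).1
      have h3 := is_const_of_deriv_eq_zero (fun t => (h2 t).differentiableAt)
        (fun t => (h2 t).deriv) t 0
      exact congrArg (krZero (k := k)) h3
    -- The `m`-th fiber coordinate keeps its initial value `0`, so the lower curve stays tangent to
    -- the critical plane that was prolonged.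
    · rw [succ_mem_critPos] at hj
      have h2 : ∀ t, HasDerivAt (fun t => ξ t (Sum.inr m)) 0 t := fun t => by
        simpa [ha] using (h1 t).2 m
      have h3 : ∀ t, ξ t (Sum.inr m) = 0 := fun t =>
        (is_const_of_deriv_eq_zero (fun t => (h2 t).differentiableAt)
          (fun t => (h2 t).deriv) t 0).trans hj.2
      exact ih (a := fun i t => a 0 t * dirCoeff (c k) (ξ t) i) (fun t => (h1 t).1) hj.1
        fun t => by simp [h3]

lemma isClosed_critPos (c : ℕ → Fin 3) (k : ℕ) (i : Fin 3) :
    IsClosed {x : KRSpace k | i ∈ critPos c k x} := by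
  induction k generalizing i with
  | zero => exact isClosed_empty
  | succ k ih =>
    refine Fin.cases ?_ (fun m => ?_) i
    · simp [zero_mem_critPos]
    · simp only [succ_mem_critPos]
      exact ((ih _).preimage (lower (α := KRIdx k)).continuous).inter
        (isClosed_singleton.preimage (continuous_apply (Sum.inr m)))

/-- Curves that are tangent to the frame and project to constant curves are tangent to
critical planes. -/
lemma exists_critPos_of_krZero_eq (c : ℕ → Fin 3) (k : ℕ) {ξ : ℝ → KRSpace k}
    {a : Fin 3 → ℝ → ℝ} {t₀ : ℝ} {p : KRSpace 0}
    (h : ∀ᶠ t in 𝓝 t₀, HasDerivAt ξ (∑ i, a i t • krFrame c k i (ξ t)) t)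
    (ha : ∀ᶠ t in 𝓝 t₀, ∀ i, ContinuousAt (a i) t) (hp : ∀ᶠ t in 𝓝 t₀, krZero (ξ t) = p)
    (h0 : ∃ i, a i t₀ ≠ 0) : ∃ i ∈ critPos c k (ξ t₀), a i t₀ = 0 := by
  induction k generalizing a t₀ with
  | zero =>
    exfalso
    obtain ⟨i, hi⟩ := h0
    apply hi
    have h1 : HasDerivAt ξ 0 t₀ :=
      (hasDerivAt_const t₀ p).congr_of_eventuallyEq (hp.mono fun t ht => ht)
    have h2 := h.self_of_nhds.unique h1
    exact Fintype.linearIndependent_iff.1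
      ((krCoords c 0).linearIndependent_frame (ξ t₀)) (fun i => a i t₀) h2 i
  | succ k ih =>
    -- If no critical plane contains the velocity, then `a 0 ≠ 0` near `t₀`; the lower curve is
    -- immersed there, and the induction hypothesis applies at every nearby time, not only at `t₀`.
    by_contra hcon
    push Not at hcon
    have h1 := h.mono fun t ht => (hasDerivAt_nextFrame_iff c k).1 ht
    have ha0 : ∀ᶠ t in 𝓝 t₀, a 0 t ≠ 0 :=
      (ha.self_of_nhds 0).eventually_ne (hcon 0 (zero_mem_critPos c k _))
    have hb : ∀ᶠ t in 𝓝 t₀, ∀ i, ContinuousAt (fun t => a 0 t * dirCoeff (c k) (ξ t) i) t := by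
      filter_upwards [ha, h1] with t h2 h3 i
      refine (h2 0).mul ?_
      rcases Fin.eq_self_or_eq_succAbove (c k) i with rfl | ⟨m, rfl⟩
      · simpa using continuousAt_const
      · simpa using (h3.2 m).continuousAt
    have key : ∀ᶠ t in 𝓝 t₀, ∃ m : Fin 2, m.succ ∈ critPos c (k + 1) (ξ t) := by
      filter_upwards [h1.eventually_nhds, hb.eventually_nhds, hp.eventually_nhds, ha0]
        with t h2 h3 h4 h5
      obtain ⟨i, hi, hi0⟩ := ih (h2.mono fun t ht => ht.1) h3 h4
        ⟨c k, by simpa using h5⟩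
      have hi0' : dirCoeff (c k) (ξ t) i = 0 := (mul_eq_zero.1 hi0).resolve_left h5
      rcases Fin.eq_self_or_eq_succAbove (c k) i with rfl | ⟨m, rfl⟩
      · simp at hi0'
      · rw [dirCoeff_succAbove] at hi0'
        exact ⟨m, (succ_mem_critPos _ _ _ _).2 ⟨hi, hi0'⟩⟩
    -- If position `m.succ` is critical at `t₀`, its fiber coordinate has nonzero derivative there
    -- and so leaves `0` at once.
    have hne : ∀ m : Fin 2, m.succ ∈ critPos c (k + 1) (ξ t₀) →
        ∀ᶠ t in 𝓝[≠] t₀, m.succ ∉ critPos c (k + 1) (ξ t) := by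
      intro m hm
      filter_upwards [(h1.self_of_nhds.2 m).eventually_ne (c := 0) (hcon _ hm)] with t ht hmt
      exact ht ((succ_mem_critPos _ _ _ _).1 hmt).2
    obtain ⟨m₀, hm₀⟩ := key.self_of_nhds
    obtain ⟨m₁, hm₁⟩ : ∃ m₁ : Fin 2, ∀ m, m ≠ m₀ → m = m₁ := by
      have : ∀ m₀ : Fin 2, ∃ m₁ : Fin 2, ∀ m, m ≠ m₀ → m = m₁ := by decide
      exact this m₀
    -- One position being lost off `t₀`, the other must be critical at all nearby times. By
    -- closedness it is critical at `t₀` too, so it is lost as well, a contradiction.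
    have h2 : ∀ᶠ t in 𝓝[≠] t₀, m₁.succ ∈ critPos c (k + 1) (ξ t) := by
      filter_upwards [hne m₀ hm₀, key.filter_mono nhdsWithin_le_nhds] with t h3 h4
      obtain ⟨m, hm⟩ := h4
      rwa [← hm₁ m fun h => h3 (h ▸ hm)]
    have h3 : Filter.Tendsto ξ (𝓝[≠] t₀) (𝓝 (ξ t₀)) :=
      h.self_of_nhds.continuousAt.tendsto.mono_left nhdsWithin_le_nhds
    have h4 : m₁.succ ∈ critPos c (k + 1) (ξ t₀) :=
      (isClosed_critPos c (k + 1) m₁.succ).mem_of_tendsto h3 h2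
    obtain ⟨t, h5, h6⟩ := (h2.and (hne m₁ h4)).exists
    exact h6 h5

/-- A given curve is lifted to coordinates and its coefficients read off by the smooth coframe, so
that `exists_critPos_of_krZero_eq` applies. Conversely, the integral curve with constant
coefficients `a` stays tangent to the critical plane and projects to a point. -/
lemma isCriticalDirection_iff (c : ℕ → Fin 3) {k : ℕ} (x : KRSpace k) {a : Fin 3 → ℝ}
    (ha : a ≠ 0) :
    IsCriticalDirection (krPoint c k x)
        (Submodule.span ℝ {fderiv ℝ (krPoint c k) x (∑ i, a i • krFrame c k i x)}) ↔
      ∃ i ∈ critPos c k x, a i = 0 := by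
  have hc := krCoords c k
  obtain ⟨θ, hθs, hθ⟩ := hc.coframe
  have hθa : ∀ (y : KRSpace k) (b : Fin 3 → ℝ) (i : Fin 3),
      θ i y (∑ l, b l • krFrame c k l y) = b i := by
    intro y b i
    simp [map_sum, hθ]
  constructor
  · rintro ⟨γ, h1, h2, h3, h4, h5⟩
    obtain ⟨ξ, hξ0, hξ⟩ := hc.exists_lift h1 h2 (h5.mono fun t ht => ht.1)
    have hd : ∀ᶠ t in 𝓝 (0 : ℝ), HasDerivAt ξ
        (∑ i, θ i (ξ t) (deriv ξ t) • krFrame c k i (ξ t)) t := by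
      filter_upwards [hξ, h5] with t h6 h7
      obtain ⟨h8, h9, h10⟩ := h6
      have h11 := h7.2.1
      rw [h9] at h11
      obtain ⟨b, hb⟩ := (krSpans c k).exists_coeff h11
      rw [h10] at hb
      have hb' := hc.fderiv_injective _ hb
      have h12 : ∑ i, θ i (ξ t) (deriv ξ t) • krFrame c k i (ξ t) = deriv ξ t := by
        rw [hb']
        simp only [hθa]
      rw [h12]
      exact (h8.differentiableAt (by simp)).hasDerivAt
    have hcont : ∀ᶠ t in 𝓝 (0 : ℝ), ∀ i,
        ContinuousAt (fun t => θ i (ξ t) (deriv ξ t)) t := by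
      filter_upwards [hξ] with t h6 i
      have h7 : ContinuousAt (fderiv ℝ ξ) t := (h6.1.fderiv_right (m := 0) (by simp)).continuousAt
      have h8 : ContinuousAt (deriv ξ) t := h7.clm_apply continuousAt_const
      exact ((hθs i).continuous.continuousAt.comp h6.1.continuousAt).clm_apply h8
    have hzero : ∀ᶠ t in 𝓝 (0 : ℝ), krZero (ξ t) = krZero x := by
      filter_upwards [hξ, h5] with t h6 h7
      have := h7.2.2
      rwa [h6.2.1, projZero_krPoint, projZero_krPoint] at this
    obtain ⟨s, hs⟩ := Submodule.mem_span_singleton.1 h4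
    have hder := hξ.self_of_nhds.2.2
    rw [hξ0] at hder
    have hs0 : s ≠ 0 := by
      rintro rfl
      exact h3 (by rw [← hs, zero_smul])
    rw [← hs, ← map_smul] at hder
    have hcoef : ∀ i, θ i (ξ 0) (deriv ξ 0) = s * a i := by
      intro i
      rw [← hc.fderiv_injective _ hder, hξ0, map_smul, hθa, smul_eq_mul]
    obtain ⟨i, hi, hi0⟩ := exists_critPos_of_krZero_eq c k hd hcont hzero (by
      obtain ⟨i, hi⟩ := Function.ne_iff.1 ha
      exact ⟨i, by rw [hcoef]; exact mul_ne_zero hs0 hi⟩)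
    rw [hξ0] at hi
    rw [hcoef] at hi0
    exact ⟨i, hi, (mul_eq_zero.1 hi0).resolve_left hs0⟩
  · rintro ⟨j, hj, hj0⟩
    obtain ⟨ξ, h1, h2, h3⟩ := exists_integralCurve c k x (fun i _ => a i) fun i => contDiff_const
    have hder : ∀ t, deriv (krPoint c k ∘ ξ) t =
        fderiv ℝ (krPoint c k) (ξ t) (∑ i, a i • krFrame c k i (ξ t)) := fun t =>
      (((hc.smooth.contDiffAt.differentiableAt (by simp)).hasFDerivAt).comp_hasDerivAt t
        (h3 t)).deriv
    refine ⟨krPoint c k ∘ ξ, hc.smooth.comp h1, congrArg _ h2, ?_, ?_,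
      Filter.Eventually.of_forall fun t => ⟨hc.mem _, ?_, ?_⟩⟩
    · rw [hder]
      intro h0
      apply ha
      funext i
      have := hc.fderiv_injective _ (h0.trans (map_zero _).symm)
      rw [← hθa (ξ 0) a i, this, map_zero]
      rfl
    · rw [hder, h2]
      exact Submodule.mem_span_singleton_self _
    · rw [hder, Function.comp_apply, krSpans c k, map_sum]
      refine Submodule.sum_mem _ fun i _ => ?_
      rw [map_smul]
      exact Submodule.smul_mem _ _ (Submodule.subset_span ⟨i, trivial, rfl⟩)
    · rw [Function.comp_apply, projZero_krPoint, projZero_krPoint,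
        krZero_eq_of_mem_critPos c k h3 (h2.symm ▸ hj) (fun _ => hj0) t, h2]

/-! ### Adapted charts -/

lemma kr_congr {c c' : ℕ → Fin 3} {k : ℕ} (h : ∀ i < k, c i = c' i) :
    krFrame c k = krFrame c' k ∧ krPoint c k = krPoint c' k ∧ IsAdapted c k = IsAdapted c' k ∧
      critPos c k = critPos c' k := by
  induction k with
  | zero => exact ⟨rfl, rfl, rfl, rfl⟩
  | succ k ih =>
    obtain ⟨h1, h2, h3, h4⟩ := ih fun i hi => h i (hi.trans (Nat.lt_succ_self k))
    have h5 := h k (Nat.lt_succ_self k)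
    refine ⟨by rw [krFrame_succ, krFrame_succ, h1, h5],
      by rw [krPoint_succ, krPoint_succ, h1, h2, h5], ?_, ?_⟩
    · funext x
      simp only [IsAdapted, h3, h5]
    · funext x
      simp only [critPos, h4, h5]

lemma adapted_iff {j : Fin 3} {α : Type} (x : α ⊕ Fin 2 → ℝ) :
    (∀ m : Fin 2, j.succAbove m < j → x (Sum.inr m) = 0) ↔ ∀ i < j, dirCoeff j x i = 0 := by
  constructor
  · intro h i hi
    rcases Fin.eq_self_or_eq_succAbove j i with rfl | ⟨m, rfl⟩
    · exact absurd hi (lt_irrefl _)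
    · rw [dirCoeff_succAbove]
      exact h m hi
  · intro h m hm
    rw [← dirCoeff_succAbove j x m]
    exact h _ hm

/-- Both coefficient vectors span the same line, and an adapted divisor is the first nonzero entry,
so the divisors agree; normalization to `1` at the divisor then fixes the scale. -/
lemma adapted_unique {c c' : ℕ → Fin 3} {k : ℕ} {x x' : KRSpace k} (hx : IsAdapted c k x)
    (hx' : IsAdapted c' k x') (h : krPoint c k x = krPoint c' k x') :
    x = x' ∧ ∀ i < k, c i = c' i := by
  induction k with
  | zero => exact ⟨h, fun i hi => absurd hi (Nat.not_lt_zero i)⟩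
  | succ k ih =>
    obtain ⟨h1, h2⟩ := hx
    obtain ⟨h1', h2'⟩ := hx'
    rw [adapted_iff] at h2 h2'
    obtain ⟨hinl, hc⟩ := ih h1 h1' (congrArg base h)
    obtain ⟨e1, e2, -, -⟩ := kr_congr hc
    have hk := krCoords c k
    rw [krPoint_succ, krPoint_succ, ← e1, ← e2] at h
    obtain ⟨-, s, hs, hs'⟩ := (pair_eq_pair_iff (hk.fderiv_dirVec_ne_zero _ _)
      (hk.fderiv_dirVec_ne_zero _ _)).1 h
    rw [← hinl, ← map_smul] at hs'
    have hs2 := hk.fderiv_injective _ hs'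
    rw [dirVec_eq, dirVec_eq, ← hinl, Finset.smul_sum] at hs2
    simp only [smul_smul] at hs2
    have hcoef : ∀ i, dirCoeff (c' k) x' i = s * dirCoeff (c k) x i := by
      intro i
      have := Fintype.linearIndependent_iff.1 (hk.linearIndependent_frame (x ∘ Sum.inl))
        (fun i => dirCoeff (c' k) x' i - s * dirCoeff (c k) x i) (by
          simp only [sub_smul, Finset.sum_sub_distrib, hs2, sub_self]) i
      exact sub_eq_zero.1 this
    have hck : c k = c' k := by
      rcases lt_trichotomy (c k) (c' k) with hlt | heq | hlt
      · have := hcoef (c k)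
        rw [h2' _ hlt, dirCoeff_self, mul_one] at this
        exact absurd this.symm hs
      · exact heq
      · have := hcoef (c' k)
        rw [h2 _ hlt, dirCoeff_self, mul_zero] at this
        exact absurd this one_ne_zero
    have hs1 : s = 1 := by
      have := hcoef (c k)
      rw [dirCoeff_self, mul_one, hck, dirCoeff_self] at this
      exact this.symm
    refine ⟨?_, fun i hi => ?_⟩
    · funext b
      rcases b with b | m
      · exact congrFun hinl b
      · have := hcoef ((c k).succAbove m)
        rw [dirCoeff_succAbove, hck, dirCoeff_succAbove, hs1, one_mul] at this
        exact this.symm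
    · rcases Nat.lt_succ_iff_lt_or_eq.1 hi with hi | rfl
      · exact hc i hi
      · exact hck

/-- Divide by the first nonzero coefficient, changing the chart sequence only at `k`. Division
preserves which coefficients vanish. -/
lemma exists_adapted_next {c : ℕ → Fin 3} {k : ℕ} {x : KRSpace k} (hx : IsAdapted c k x)
    {a : Fin 3 → ℝ} (ha : a ≠ 0) :
    ∃ (c' : ℕ → Fin 3) (y : KRSpace (k + 1)), IsAdapted c' (k + 1) y ∧ (∀ i < k, c' i = c i) ∧
      y ∘ Sum.inl = x ∧ krPoint c' (k + 1) y =
        pair (krPoint c k x) (fderiv ℝ (krPoint c k) x (∑ i, a i • krFrame c k i x)) ∧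
      ∀ i, dirCoeff (c' k) y i = 0 ↔ a i = 0 := by
  obtain ⟨j, hj, hmin⟩ := wellFounded_lt.has_min {j | a j ≠ 0} (Function.ne_iff.1 ha)
  have hmin' : ∀ i < j, a i = 0 := fun i hi => by
    by_contra h
    exact hmin i h hi
  have hc : ∀ i < k, Function.update c k j i = c i := fun i hi =>
    Function.update_of_ne hi.ne _ _
  have hck : Function.update c k j k = j := Function.update_self _ _ _
  obtain ⟨e1, e2, e3, -⟩ := kr_congr hc
  let y : KRSpace (k + 1) := Sum.elim x fun m => a (j.succAbove m) / a j
  have hcoef : ∀ i, dirCoeff j y i = a i / a j := by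
    intro i
    rcases Fin.eq_self_or_eq_succAbove j i with rfl | ⟨m, rfl⟩
    · rw [dirCoeff_self, div_self hj]
    · rw [dirCoeff_succAbove]
      rfl
  refine ⟨Function.update c k j, y, ⟨?_, ?_⟩, hc, rfl, ?_, ?_⟩
  · rw [e3]
    exact hx
  · rw [hck, adapted_iff]
    intro i hi
    rw [hcoef, hmin' i hi, zero_div]
  · rw [krPoint_succ, e1, e2, hck]
    exact (nextMap_of_coeff _ _ x a j hj).symm
  · intro i
    rw [hck, hcoef, div_eq_zero_iff, or_iff_left hj]

lemma exists_adapted {k : ℕ} {p : Amb k} (hp : p ∈ (tower k).carrier) :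
    ∃ (c : ℕ → Fin 3) (x : KRSpace k), IsAdapted c k x ∧ krPoint c k x = p := by
  induction k with
  | zero => exact ⟨fun _ => 0, p, trivial, rfl⟩
  | succ k ih =>
    obtain ⟨p, hp, w, hw, hw0, rfl⟩ := hp
    obtain ⟨c, x, hx, rfl⟩ := ih hp
    obtain ⟨a, rfl⟩ := (krSpans c k).exists_coeff hw
    obtain ⟨c', y, hy, -, -, h, -⟩ := exists_adapted_next hx (a := a) (by
      rintro rfl
      exact hw0 (by simp))
    exact ⟨c', y, hy, h⟩

/-! ### Letters in coordinates -/

/-- The line `ℓ` of the point with coordinates `y` lies in the plane at position `i`. -/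
lemma dirOf_le_krPlane_iff (c : ℕ → Fin 3) {k : ℕ} (y : KRSpace (k + 1)) (i : Fin 3) :
    dirOf (krPoint c (k + 1) y) ≤ krPlane c k (y ∘ Sum.inl) i ↔ dirCoeff (c k) y i = 0 := by
  rw [dirOf, krPoint_succ, line_nextMap (krCoords c k), Submodule.span_singleton_le_iff_mem,
    fderiv_dirVec_eq, sum_smul_mem_krPlane_iff]

/-- The existential over adapted charts collapses by `adapted_unique`, and `krPlane_injective`
recovers the position from the plane. -/
lemma isTangencyPlane_iff {c : ℕ → Fin 3} {k : ℕ} {x : KRSpace k} (hx : IsAdapted c k x)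
    (i : Fin 3) (H : Submodule ℝ (Amb k)) :
    IsTangencyPlane i (krPoint c k x) H ↔ i ∈ critPos c k x ∧ H = krPlane c k x i := by
  constructor
  · rintro ⟨hcrit, c', x', hx', hp, rfl⟩
    obtain ⟨rfl, hc⟩ := adapted_unique hx' hx hp
    have hpl : krPlane c' k x' i = krPlane c k x' i := by
      rw [krPlane, krPlane, (kr_congr hc).1, (kr_congr hc).2.1]
    rw [hpl] at hcrit ⊢
    obtain ⟨l, hl, hil⟩ := (isCriticalPlane_iff c x' _).1 hcrit
    rw [krPlane_injective c k x' hil]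
    exact ⟨hl, rfl⟩
  · rintro ⟨hi, rfl⟩
    exact ⟨(isCriticalPlane_iff c x _).2 ⟨i, hi, rfl⟩, c, x, hx, rfl, rfl⟩

open Classical in
/-- The positions of the critical planes that contain the line of the point with coordinates `y`. -/
def zeroPos (c : ℕ → Fin 3) {k : ℕ} (y : KRSpace (k + 1)) : Finset (Fin 3) :=
  {i | i ∈ critPos c k (y ∘ Sum.inl) ∧ dirCoeff (c k) y i = 0}

lemma mem_zeroPos {c : ℕ → Fin 3} {k : ℕ} {y : KRSpace (k + 1)} {i : Fin 3} :
    i ∈ zeroPos c y ↔ i ∈ critPos c k (y ∘ Sum.inl) ∧ dirCoeff (c k) y i = 0 := by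
  simp [zeroPos]

lemma inT_iff {c : ℕ → Fin 3} {k : ℕ} {y : KRSpace (k + 1)} (hy : IsAdapted c (k + 1) y)
    (i : Fin 3) :
    InT i (proj (krPoint c (k + 1) y)) (dirOf (krPoint c (k + 1) y)) ↔ i ∈ zeroPos c y := by
  rw [mem_zeroPos, ← dirOf_le_krPlane_iff]
  constructor
  · rintro ⟨H, hH, hl⟩
    obtain ⟨hi, rfl⟩ := (isTangencyPlane_iff hy.1 i H).1 hH
    exact ⟨hi, hl⟩
  · rintro ⟨hi, hl⟩
    exact ⟨_, (isTangencyPlane_iff hy.1 i _).2 ⟨hi, rfl⟩, hl⟩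

lemma inV_iff (c : ℕ → Fin 3) {k : ℕ} (y : KRSpace (k + 1)) :
    InV (proj (krPoint c (k + 1) y)) (dirOf (krPoint c (k + 1) y)) ↔ 0 ∈ zeroPos c y := by
  rw [mem_zeroPos, ← dirOf_le_krPlane_iff]
  constructor
  · rintro ⟨H, hH, hl⟩
    obtain ⟨hi, rfl⟩ := (isVerticalPlane_iff c _ H).1 hH
    exact ⟨hi, hl⟩
  · rintro ⟨hi, hl⟩
    exact ⟨_, (isVerticalPlane_iff c _ _).2 ⟨hi, rfl⟩, hl⟩

lemma isCriticalDirection_dirOf_iff (c : ℕ → Fin 3) {k : ℕ} (y : KRSpace (k + 1)) :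
    IsCriticalDirection (proj (krPoint c (k + 1) y)) (dirOf (krPoint c (k + 1) y)) ↔
      (zeroPos c y).Nonempty := by
  rw [dirOf, krPoint_succ, line_nextMap (krCoords c k), dirVec_eq]
  refine (isCriticalDirection_iff c (y ∘ Sum.inl) (a := dirCoeff (c k) y) fun h => ?_).trans ?_
  · have := congrFun h (c k)
    simp at this
  · exact exists_congr fun i => mem_zeroPos.symm

/-- The positions of the planes, among `V`, `T₁`, `T₂`, that contain a line with the given letter. -/
def Letter.planes : Letter → Finset (Fin 3)
  | .R => ∅
  | .V => {0}
  | .T₁ => {1}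
  | .T₂ => {2}
  | .L₁ => {0, 1}
  | .L₂ => {1, 2}
  | .L₃ => {0, 2}

/-- The positions of the critical planes at a point whose last letter is given. -/
def Letter.nextPlanes : Letter → Finset (Fin 3)
  | .R => {0}
  | .V => {0, 1}
  | .T₁ => {0, 1}
  | .T₂ => {0, 2}
  | .L₁ => Finset.univ
  | .L₂ => Finset.univ
  | .L₃ => Finset.univ

lemma Letter.planes_injective : Function.Injective Letter.planes := by
  intro X Y h
  cases X <;> cases Y <;> first | rfl | exact absurd h (by decide)

lemma Letter.planes_ne_univ (X : Letter) : X.planes ≠ Finset.univ := by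
  cases X <;> decide

lemma Letter.exists_planes_eq {Z : Finset (Fin 3)} (hZ : Z ≠ Finset.univ) :
    ∃ X : Letter, X.planes = Z := by
  have : ∀ Z : Finset (Fin 3), Z ≠ Finset.univ → Z = ∅ ∨ Z = {0} ∨ Z = {1} ∨ Z = {2} ∨
      Z = {0, 1} ∨ Z = {1, 2} ∨ Z = {0, 2} := by decide
  rcases this Z hZ with rfl | rfl | rfl | rfl | rfl | rfl | rfl
  exacts [⟨.R, rfl⟩, ⟨.V, rfl⟩, ⟨.T₁, rfl⟩, ⟨.T₂, rfl⟩, ⟨.L₁, rfl⟩, ⟨.L₂, rfl⟩, ⟨.L₃, rfl⟩]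

lemma mem_allowedAfter_iff (X Y : Letter) : Y ∈ allowedAfter X ↔ Y.planes ⊆ X.nextPlanes := by
  cases X <;> cases Y <;> simp [allowedAfter, Letter.planes, Letter.nextPlanes] <;> decide

/-- The divisor coefficient is `1`, so its position is always missing. -/
lemma zeroPos_ne_univ (c : ℕ → Fin 3) {k : ℕ} (y : KRSpace (k + 1)) :
    zeroPos c y ≠ Finset.univ := by
  intro h
  have := (mem_zeroPos.1 (h ▸ Finset.mem_univ (c k))).2
  simp at this

lemma hasLetter_iff {c : ℕ → Fin 3} {k : ℕ} {y : KRSpace (k + 1)} (hy : IsAdapted c (k + 1) y)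
    (X : Letter) : HasLetter (krPoint c (k + 1) y) X ↔ X.planes = zeroPos c y := by
  -- The definition of each `L` letter names two planes without excluding the third; properness
  -- excludes it.
  have hne := zeroPos_ne_univ c y
  cases X <;>
    simp only [HasLetter, inT_iff hy, inV_iff, isCriticalDirection_dirOf_iff, Letter.planes] <;>
    generalize zeroPos c y = Z at hne <;> revert Z <;> decide

/-- The new positions depend on the divisor as well as on the letter. Adaptedness restricts the
divisor enough that a finite check over the remaining values always gives the same set. -/
lemma critPos_of_hasLetter {c : ℕ → Fin 3} {k : ℕ} {y : KRSpace (k + 1)}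
    (hy : IsAdapted c (k + 1) y) {X : Letter} (hX : HasLetter (krPoint c (k + 1) y) X)
    (i : Fin 3) : i ∈ critPos c (k + 1) y ↔ i ∈ X.nextPlanes := by
  rw [hasLetter_iff hy] at hX
  have hj : c k ∉ X.planes := by
    rw [hX, mem_zeroPos]
    simp
  -- Some critical plane exists, so the level is at least `1` and the vertical plane is critical. A
  -- divisor other than `0` would make the coefficient at `0` vanish, putting the line in the
  -- vertical plane.
  have h0 : X.planes.Nonempty → 0 ∉ X.planes → c k = 0 := by
    rw [hX]
    rintro ⟨l, hl⟩ h
    by_contra hck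
    refine h (mem_zeroPos.2 ⟨?_, (adapted_iff y).1 hy.2 0 (Fin.pos_of_ne_zero hck)⟩)
    have hl' := (mem_zeroPos.1 hl).1
    cases k with
    | zero => exact absurd hl' id
    | succ k => exact zero_mem_critPos c k _
  have hcrit : i ∈ critPos c (k + 1) y ↔
      ∀ m : Fin 2, i = m.succ → (c k).succAbove m ∈ X.planes := by
    refine forall_congr' fun m => imp_congr_right fun _ => ?_
    rw [hX, mem_zeroPos, dirCoeff_succAbove]
  rw [hcrit]
  clear hcrit
  generalize c k = j at hj h0
  cases X <;> simp only [Letter.planes, Letter.nextPlanes] at hj h0 ⊢ <;> revert i j <;> decide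

lemma existsUnique_hasLetter {k : ℕ} {q : Amb (k + 1)} (hq : q ∈ (tower (k + 1)).carrier) :
    ∃! X, HasLetter q X := by
  obtain ⟨c, y, hy, rfl⟩ := exists_adapted hq
  obtain ⟨X, hX⟩ := Letter.exists_planes_eq (zeroPos_ne_univ c y)
  exact ⟨X, (hasLetter_iff hy X).2 hX, fun Y hY =>
    Letter.planes_injective (((hasLetter_iff hy Y).1 hY).trans hX.symm)⟩

lemma exists_hasLetter {c : ℕ → Fin 3} {k : ℕ} {x : KRSpace k} (hx : IsAdapted c k x)
    {Y : Letter} (hY : ∀ i ∈ Y.planes, i ∈ critPos c k x) :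
    ∃ q ∈ (tower (k + 1)).carrier, proj q = krPoint c k x ∧ HasLetter q Y := by
  obtain ⟨j, hj⟩ : ∃ j, j ∉ Y.planes := by
    by_contra! h
    exact Y.planes_ne_univ (Finset.eq_univ_of_forall h)
  -- The direction with coefficient `0` exactly at the planes of `Y`; it is nonzero because some
  -- position `j` is left over.
  obtain ⟨c', y, hy, hc, hyx, hq, ha⟩ := exists_adapted_next hx
    (a := fun i => if i ∈ Y.planes then 0 else 1) fun h => by simpa [hj] using congrFun h j
  refine ⟨_, (krCoords c' (k + 1)).mem y, by rw [hq]; rfl, (hasLetter_iff hy Y).2 ?_⟩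
  ext i
  rw [mem_zeroPos, ha, hyx, (kr_congr hc).2.2.2]
  constructor
  · exact fun hi => ⟨hY i hi, by simp [hi]⟩
  · intro hi
    by_contra h
    simp [h] at hi

/-! ### Codes -/

lemma proj_mem {k : ℕ} {q : Amb (k + 1)} (hq : q ∈ (tower (k + 1)).carrier) :
    proj q ∈ (tower k).carrier := by
  obtain ⟨p, hp, w, -, -, rfl⟩ := hq
  exact hp

lemma existsUnique_hasCode {k : ℕ} {p : Amb k} (hp : p ∈ (tower k).carrier) :
    ∃! s, HasCode p s := by
  induction k with
  | zero => exact ⟨[], rfl, fun s hs => hs⟩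
  | succ k ih =>
    obtain ⟨s, hs, hs'⟩ := ih (proj_mem hp)
    obtain ⟨X, hX, hX'⟩ := existsUnique_hasLetter hp
    refine ⟨s ++ [X], ⟨s, X, rfl, hs, hX⟩, ?_⟩
    rintro _ ⟨s₁, X₁, rfl, h1, h2⟩
    rw [hs' s₁ h1, hX' X₁ h2]

lemma hasCode_length {k : ℕ} {p : Amb k} {s : List Letter} (h : HasCode p s) : s.length = k := by
  induction k generalizing s with
  | zero =>
    have : s = [] := h
    rw [this]
    rfl
  | succ k ih =>
    obtain ⟨s, X, rfl, h1, -⟩ := h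
    simp [ih h1]

lemma hasCode_concat_iff {k : ℕ} {q : Amb (k + 1)} {s : List Letter} {X : Letter} :
    HasCode q (s ++ [X]) ↔ HasCode (proj q) s ∧ HasLetter q X := by
  constructor
  · rintro ⟨s', X', h, h1, h2⟩
    obtain ⟨rfl, h3⟩ := List.append_inj' h rfl
    obtain rfl : X = X' := by simpa using h3
    exact ⟨h1, h2⟩
  · rintro ⟨h1, h2⟩
    exact ⟨s, X, rfl, h1, h2⟩

/-- By `mem_allowedAfter_iff` the rules say that the planes of `Y` are among those available after
`X`. This is necessary because letters record critical planes only, and sufficient by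
`exists_hasLetter`. -/
lemma next_letter_iff {k : ℕ} {p : Amb k} (hp : p ∈ (tower k).carrier) {s : List Letter}
    {X : Letter} (h : HasCode p (s ++ [X])) (Y : Letter) :
    (∃ q ∈ (tower (k + 1)).carrier, proj q = p ∧ HasCode q (s ++ [X, Y])) ↔
      Y ∈ allowedAfter X := by
  have hsplit : s ++ [X, Y] = (s ++ [X]) ++ [Y] := by simp
  rw [mem_allowedAfter_iff, hsplit]
  cases k with
  | zero => exact absurd (hasCode_length h) (by simp)
  | succ k =>
    constructor
    · rintro ⟨q, hq, rfl, hqY⟩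
      obtain ⟨c, y, hy, rfl⟩ := exists_adapted hq
      have h1 := (hasLetter_iff hy Y).1 (hasCode_concat_iff.1 hqY).2
      intro i hi
      rw [h1, mem_zeroPos] at hi
      exact (critPos_of_hasLetter hy.1 (hasCode_concat_iff.1 h).2 i).1 hi.1
    · intro hY
      obtain ⟨c, x, hx, rfl⟩ := exists_adapted hp
      obtain ⟨q, hq, hqp, hqY⟩ := exists_hasLetter hx (Y := Y) fun i hi =>
        (critPos_of_hasLetter hx (hasCode_concat_iff.1 h).2 i).2 (hY hi)
      exact ⟨q, hq, hqp, hasCode_concat_iff.2 ⟨hqp.symm ▸ h, hqY⟩⟩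

lemma first_letter_iff (X : Letter) :
    (∃ q ∈ (tower 1).carrier, HasLetter q X) ↔ X = .R := by
  constructor
  · rintro ⟨q, hq, hX⟩
    obtain ⟨c, y, hy, rfl⟩ := exists_adapted hq
    rw [hasLetter_iff hy] at hX
    have : zeroPos c y = ∅ :=
      Finset.eq_empty_of_forall_notMem fun i hi => (mem_zeroPos.1 hi).1
    exact Letter.planes_injective (hX.trans this)
  · rintro rfl
    obtain ⟨q, hq, -, hR⟩ := exists_hasLetter (c := fun _ => 0) (k := 0) (x := 0) trivial
      (Y := .R) fun i hi => absurd hi (Finset.notMem_empty i)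
    exact ⟨q, hq, hR⟩

lemma isChain_concat_iff (s : List Letter) (X Y : Letter) :
    (s ++ [X, Y]).IsChain (fun X Y => Y ∈ allowedAfter X) ↔
      (s ++ [X]).IsChain (fun X Y => Y ∈ allowedAfter X) ∧ Y ∈ allowedAfter X := by
  have : s ++ [X, Y] = (s ++ [X]) ++ [Y] := by simp
  rw [this, List.isChain_append]
  simp

lemma spelling_of_hasCode {k : ℕ} (hk : 1 ≤ k) {p : Amb k} (hp : p ∈ (tower k).carrier)
    {s : List Letter} (h : HasCode p s) :
    s.head? = some .R ∧ s.IsChain (fun X Y => Y ∈ allowedAfter X) := by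
  induction k generalizing s with
  | zero => exact absurd hk (by decide)
  | succ k ih =>
    obtain ⟨s, Y, rfl, hs, hY⟩ := h
    rcases List.eq_nil_or_concat s with rfl | ⟨s, X, rfl⟩
    · obtain rfl : 0 = k := hasCode_length hs
      obtain rfl := (first_letter_iff Y).1 ⟨p, hp, hY⟩
      simp
    · have hk' : 1 ≤ k := by
        rw [← hasCode_length hs]
        simp
      obtain ⟨h1, h2⟩ := ih hk' (proj_mem hp) hs
      rw [List.concat_eq_append] at h1 h2 hs ⊢
      rw [List.append_assoc]
      refine ⟨?_, (isChain_concat_iff s X Y).2 ⟨h2, ?_⟩⟩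
      · cases s <;> simpa using h1
      · refine (next_letter_iff (proj_mem hp) hs Y).1 ⟨p, hp, rfl, ?_⟩
        have := hasCode_concat_iff.2 ⟨hs, hY⟩
        simpa using this

/-- Codes grow at the right end, so the word is built from the right by `next_letter_iff`, which
works over any point with the given code. -/
lemma exists_hasCode_of_spelling {s : List Letter} (h0 : s.head? = some .R)
    (h : s.IsChain (fun X Y => Y ∈ allowedAfter X)) :
    ∃ k, ∃ p ∈ (tower k).carrier, HasCode p s := by
  induction s using List.reverseRecOn with
  | nil => simp at h0
  | append_singleton s Y ih =>
    rcases List.eq_nil_or_concat s with rfl | ⟨s, X, rfl⟩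
    · obtain rfl : Y = .R := by simpa using h0
      obtain ⟨q, hq, hR⟩ := (first_letter_iff .R).2 rfl
      exact ⟨1, q, hq, hasCode_concat_iff.2 ⟨rfl, hR⟩⟩
    · rw [List.concat_eq_append] at *
      rw [List.append_assoc] at h ⊢
      obtain ⟨h1, h2⟩ := (isChain_concat_iff s X Y).1 h
      obtain ⟨k, p, hp, hps⟩ := ih (by cases s <;> simpa using h0) h1
      obtain ⟨q, hq, -, hqs⟩ := (next_letter_iff hp hps Y).2 h2
      exact ⟨k + 1, q, hq, hqs⟩

end Monster

end

/-- The complete spelling rules for RVT codes in the `ℝ³`-Monster Tower: every point has exactly one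
code; every code starts with `R`; over every point, the letters that occur next are exactly
those that the rules allow after its last letter; and the words that occur as codes are
exactly those that obey the rules. -/
theorem theorem2p1 :
    (∀ (k : ℕ), ∀ p ∈ (Monster.tower k).carrier, ∃! s, Monster.HasCode p s) ∧
    (∀ (k : ℕ), 1 ≤ k → ∀ p ∈ (Monster.tower k).carrier, ∀ s, Monster.HasCode p s →
      s.head? = some Monster.Letter.R) ∧
    (∀ (k : ℕ), ∀ p ∈ (Monster.tower k).carrier, ∀ (s : List Monster.Letter) (X : Monster.Letter),
      Monster.HasCode p (s ++ [X]) → ∀ Y : Monster.Letter,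
        (∃ q ∈ (Monster.tower (k + 1)).carrier,
          Monster.proj q = p ∧ Monster.HasCode q (s ++ [X, Y])) ↔
        Y ∈ Monster.allowedAfter X) ∧
    (∀ s : List Monster.Letter, s ≠ [] →
      ((∃ k, ∃ p ∈ (Monster.tower k).carrier, Monster.HasCode p s) ↔
        s.head? = some Monster.Letter.R ∧
          s.IsChain (fun X Y => Y ∈ Monster.allowedAfter X))) := by
  refine ⟨fun k p hp => Monster.existsUnique_hasCode hp,
    fun k hk p hp s h => (Monster.spelling_of_hasCode hk hp h).1,
    fun k p hp s X h Y => Monster.next_letter_iff hp h Y, fun s hs => ⟨?_, ?_⟩⟩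
  · rintro ⟨k, p, hp, h⟩
    refine Monster.spelling_of_hasCode (Nat.one_le_iff_ne_zero.2 ?_) hp h
    rintro rfl
    exact hs h
  · rintro ⟨h0, h⟩
    exact Monster.exists_hasCode_of_spelling h0 h
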